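/- Let $d\ge 2$ and let $\mathcal E'(\mathbb R^d)$ be the space of compactly supported (complex-valued) distributions on $\mathbb R^d$. Let $\Gamma=\{(z,\theta):\theta\in S^{d-1},\ z\in\mathbb R^d,\ z\cdot\theta=0\}$ be the smooth manifold of oriented lines, where $(z,\theta)$ stands for the line $\{z+s\theta: s\in\mathbb R\}$. For $\eta\in C^\infty(\Gamma)$ put $$X^*\eta(x)=\int_{S^{d-1}}\eta\bigl(x-(x\cdot\theta)\theta,\theta\bigr)\,d\theta\in C^\infty(\mathbb R^d),$$ where $d\theta$ is the surface measure, and define the X-ray transform $Xf$ of $f\in\mathcal E'(\mathbb R^d)$ by duality: $\langle Xf,\eta\rangle=\langle f,X^*\eta\rangle$ for all $\eta\in C^\infty(\Gamma)$. For an open set $V\subset\mathbb R^d$ let $\Gamma_V\subset\Gamma$ be the set of lines that intersect $V$; we say that $Xf$ vanishes on all lines that intersect $V$ if $\langle Xf,\eta\rangle=0$ for every $\eta\in C_c^\infty(\Gamma)$ whose support is contained in $\Gamma_V$. Let $V\subset\mathbb R^d$ be a nonempty open set and $f\in\mathcal E'(\mathbb R^d)$. If $f|_V=0$ and $Xf$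 vanishes on all lines that intersect $V$, then $f=0$. -/

import Mathlib

open MeasureTheory Set Topology Distribution
open scoped ContDiff Distributions InnerProductSpace

namespace XRay

noncomputable section

/-- `d`-dimensional Euclidean space. -/
abbrev Space (d : ℕ) : Type := EuclideanSpace ℝ (Fin d)

/-- The space of all distributions on `ℝ^d` with complex values. -/
abbrev Distr (d : ℕ) : Type := 𝓓'((⊤ : TopologicalSpace.Opens (Space d)), ℂ)

/-- Real valued test functions on `ℝ^d`, against which distributions are tested. -/
abbrev Test (d : ℕ) : Type := 𝓓((⊤ : TopologicalSpace.Opens (Space d)), ℝ)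

/-- The real vector space of smooth functions on `ℝ^d`. -/
def SmoothFun (d : ℕ) : Submodule ℝ (Space d → ℝ) where
  carrier := {ψ | ContDiff ℝ ∞ ψ}
  add_mem' {a b} (ha : ContDiff ℝ ∞ a) (hb : ContDiff ℝ ∞ b) := ha.add hb
  zero_mem' := (contDiff_const : ContDiff ℝ ∞ fun _ : Space d => (0 : ℝ))
  smul_mem' _ ψ (h : ContDiff ℝ ∞ ψ) := contDiff_const.smul h

/-! ### Pairing of a compactly supported distribution with a smooth function -/

/-- The product of a test function and a smooth function, as a test function. -/
def mulTest {d : ℕ} (χ : Test d) (ψ : SmoothFun d) : Test d where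
  toFun x := χ x * ψ.1 x
  contDiff' := χ.contDiff.mul ψ.2
  hasCompactSupport' := χ.hasCompactSupport.mul_right
  tsupport_subset' := subset_univ _

/-- `χ` is a cutoff function for the set `K`: it equals `1` in a neighbourhood of `K`. -/
def IsCutoff {d : ℕ} (K : Set (Space d)) (χ : Test d) : Prop :=
  ∀ᶠ x in 𝓝ˢ K, χ x = 1

theorem exists_isCutoff_subset {d : ℕ} {K U : Set (Space d)} (hK : IsCompact K) (hU : IsOpen U)
    (hKU : K ⊆ U) : ∃ χ : Test d, IsCutoff K χ ∧ tsupport χ ⊆ U := by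
  obtain ⟨L, hL, hKL, hLU⟩ := exists_compact_between hK hU hKU
  obtain ⟨g, hg1, hg0, -⟩ := exists_contMDiffMap_one_nhds_of_subset_interior
    (modelWithCornersSelf ℝ (Space d)) (n := (⊤ : ℕ∞)) hK.isClosed hKL
  have hs : tsupport g ⊆ L :=
    closure_minimal (fun x hx => by_contra fun h => hx (hg0 x h)) hL.isClosed
  exact ⟨⟨g, g.contMDiff.contDiff, hL.of_isClosed_subset (isClosed_tsupport _) hs, subset_univ _⟩,
    hg1, hs.trans hLU⟩

theorem exists_isCutoff {d : ℕ} {K : Set (Space d)} (hK : IsCompact K) :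
    ∃ χ : Test d, IsCutoff K χ :=
  (exists_isCutoff_subset hK isOpen_univ (subset_univ K)).imp fun _ h => h.1

/-- The canonical extension of a compactly supported distribution `f` to a linear functional on all
smooth functions: `⟨f, ψ⟩ = ⟨f, χ ψ⟩`, where `χ` is a test function that equals `1` near the
support of `f`. The value does not depend on `χ`, see `pair_eq`. -/
def pair {d : ℕ} (f : Distr d) (hf : IsCompact (dsupport f)) : SmoothFun d →ₗ[ℝ] ℂ where
  toFun ψ := f (mulTest (exists_isCutoff hf).choose ψ)
  map_add' a b := by
    rw [← map_add]
    congr 1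
    ext x
    exact mul_add _ _ _
  map_smul' c a := by
    rw [RingHom.id_apply, ← map_smul]
    congr 1
    ext x
    exact mul_left_comm _ _ _

theorem isVanishingOn_compl_dsupport {d : ℕ} (f : Distr d) :
    IsVanishingOn f (dsupport f)ᶜ := by
  have hunion : ∀ {A B : Set (Space d)}, IsOpen A → IsOpen B → IsVanishingOn f A →
      IsVanishingOn f B → IsVanishingOn f (A ∪ B) := by
    intro A B hA hB hfA hfB u hu
    obtain ⟨χ, hχ, hχA⟩ := exists_isCutoff_subset
      (IsCompact.diff (s := tsupport u) u.hasCompactSupport hB) hA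
      (fun x hx => (hu hx.1).resolve_right hx.2)
    let u₁ : Test d := mulTest χ ⟨u, u.contDiff⟩
    have h1 : f u₁ = 0 := hfA _ ((tsupport_mul_subset_left (f := χ) (g := u)).trans hχA)
    have h2 : f (u - u₁) = 0 := by
      refine hfB _ fun x hx => ?_
      by_contra hxB
      have hval : ∀ y, (u - u₁) y = u y - χ y * u y := fun y => rfl
      have hxu : x ∈ tsupport u := by
        refine closure_mono (fun y hy => ?_) hx
        rw [Function.mem_support, hval] at hy
        intro h
        exact hy (by simp [h])
      have : (u - u₁ : Test d) =ᶠ[𝓝 x] 0 := by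
        have hxK : x ∈ tsupport u \ B := ⟨hxu, hxB⟩
        filter_upwards [hχ.filter_mono (nhds_le_nhdsSet hxK)] with y hy
        rw [hval, hy]
        simp
      exact (notMem_tsupport_iff_eventuallyEq.2 this) hx
    rw [map_sub, h1, sub_zero] at h2
    exact h2
  intro u hu
  obtain ⟨A, -, hA, hfA⟩ : ∃ A, IsOpen A ∧ tsupport u ⊆ A ∧ IsVanishingOn f A := by
    refine u.hasCompactSupport.isCompact.induction_on
      (p := fun s => ∃ A, IsOpen A ∧ s ⊆ A ∧ IsVanishingOn f A) ?_ ?_ ?_ ?_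
    · refine ⟨∅, isOpen_empty, Subset.rfl, fun v hv => ?_⟩
      have : v = 0 := DFunLike.coe_injective (tsupport_eq_empty_iff.1 (subset_empty_iff.1 hv))
      rw [this, map_zero]
    · rintro s t hst ⟨A, hA, htA, hfA⟩
      exact ⟨A, hA, hst.trans htA, hfA⟩
    · rintro s t ⟨A, hA, hsA, hfA⟩ ⟨B, hB, htB, hfB⟩
      exact ⟨A ∪ B, hA.union hB, union_subset_union hsA htB, hunion hA hB hfA hfB⟩
    · intro x hx
      obtain ⟨A, hfA, hA, hxA⟩ := (notMem_dsupport_iff x).1 (hu hx)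
      exact ⟨A, mem_nhdsWithin_of_mem_nhds (hA.mem_nhds hxA), A, hA, Subset.rfl, hfA⟩
  exact hfA u hA

theorem pair_eq {d : ℕ} (f : Distr d) (hf : IsCompact (dsupport f)) (χ : Test d)
    (hχ : IsCutoff (dsupport f) χ) (ψ : SmoothFun d) :
    pair f hf ψ = f (mulTest χ ψ) := by
  change f (mulTest (exists_isCutoff hf).choose ψ) = _
  have hχ' := (exists_isCutoff hf).choose_spec
  set χ' := (exists_isCutoff hf).choose
  rw [← sub_eq_zero, ← map_sub]
  refine isVanishingOn_compl_dsupport f _ fun x hx hxf => ?_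
  have : (mulTest χ' ψ - mulTest χ ψ : Test d) =ᶠ[𝓝 x] 0 := by
    filter_upwards [hχ.filter_mono (nhds_le_nhdsSet hxf),
      hχ'.filter_mono (nhds_le_nhdsSet hxf)] with y hy hy'
    change χ' y * ψ.1 y - χ y * ψ.1 y = 0
    rw [hy, hy', sub_self]
  exact (notMem_tsupport_iff_eventuallyEq.2 this) hx

/-! ### The manifold of oriented lines -/

/-- The manifold `Γ` of oriented lines in `ℝ^d`, parametrized by the pairs `(z, θ)` with `θ` in the
unit sphere and `z` orthogonal to `θ`; the pair stands for the line `s ↦ z + s θ`. It is a closed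
submanifold of `ℝ^d × ℝ^d`, and has the induced topology. -/
abbrev Line (d : ℕ) : Type :=
  {γ : Space d × Space d // ‖γ.2‖ = 1 ∧ ⟪γ.1, γ.2⟫_ℝ = 0}

/-- The set of all lines that meet `V`. -/
def linesMeeting {d : ℕ} (V : Set (Space d)) : Set (Line d) :=
  {γ | ∃ s : ℝ, γ.1.1 + s • γ.1.2 ∈ V}

/-- A function on `Γ` is smooth if near every point it is the restriction of a smooth function
of the ambient space `ℝ^d × ℝ^d`. -/
def IsSmoothOnLines {d : ℕ} (η : Line d → ℝ) : Prop :=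
  ∀ γ : Line d, ∃ g : Space d × Space d → ℝ, ContDiff ℝ ∞ g ∧
    ∀ᶠ γ' in 𝓝 γ, η γ' = g γ'.1

/-- The real vector space of smooth functions on `Γ`. -/
def SmoothLineFun (d : ℕ) : Submodule ℝ (Line d → ℝ) where
  carrier := {η | IsSmoothOnLines η}
  add_mem' := by
    intro a b ha hb γ
    obtain ⟨g, hg, hga⟩ := ha γ
    obtain ⟨h, hh, hhb⟩ := hb γ
    refine ⟨g + h, hg.add hh, ?_⟩
    filter_upwards [hga, hhb] with γ' h1 h2
    simp [h1, h2]
  zero_mem' γ := ⟨0, contDiff_const, by simp⟩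
  smul_mem' := by
    intro c a ha γ
    obtain ⟨g, hg, hga⟩ := ha γ
    refine ⟨c • g, contDiff_const.smul hg, ?_⟩
    filter_upwards [hga] with γ' h1
    simp [h1]

/-- The line through the point `x` with direction `θ`. -/
def lineThrough {d : ℕ} (x : Space d) (θ : Metric.sphere (0 : Space d) 1) : Line d :=
  ⟨(x - ⟪x, θ.1⟫_ℝ • θ.1, θ.1), by
    have h : ‖θ.1‖ = 1 := by simp
    refine ⟨h, ?_⟩
    simp [inner_sub_left, inner_smul_left, h]⟩

/-- The function `X^* η (x) = ∫_{S^{d-1}} η(x - (x·θ) θ, θ) dθ`, where `dθ` is the surface measure: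
the integral of `η` over all lines through `x`. -/
def backprojFun {d : ℕ} (η : Line d → ℝ) (x : Space d) : ℝ :=
  ∫ θ, η (lineThrough x θ) ∂(volume : Measure (Space d)).toSphere

theorem contDiff_integral_aux {X E P : Type} [TopologicalSpace X] [CompactSpace X] [T2Space X]
    [MeasurableSpace X] [BorelSpace X] [SecondCountableTopology X]
    {μ : Measure X} [IsFiniteMeasure μ]
    [NormedAddCommGroup E] [NormedSpace ℝ E] [FiniteDimensional ℝ E]
    [NormedAddCommGroup P] [NormedSpace ℝ P]
    {ι : X → P} (hι : Continuous ι) {U : Set (E × P)} (hU : IsOpen U)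
    (hιU : ∀ x t, (x, ι t) ∈ U) (n : ℕ) :
    ∀ {F : Type} [NormedAddCommGroup F] [NormedSpace ℝ F] {H : E × P → F},
      ContDiffOn ℝ ∞ H U → ContDiff ℝ n (fun x => ∫ t, H (x, ι t) ∂μ) := by
  have hc : ∀ {F : Type} [NormedAddCommGroup F] {H : E × P → F}, ContinuousOn H U →
      Continuous (fun q : E × X => H (q.1, ι q.2)) := fun hH =>
    hH.comp_continuous (by fun_prop) (fun q => hιU q.1 q.2)
  induction n with
  | zero =>
    intro F _ _ H hH
    rw [Nat.cast_zero, contDiff_zero]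
    have := continuous_parametric_integral_of_continuous (μ := μ)
      (f := fun x t => H (x, ι t)) (hc hH.continuousOn) (isCompact_univ (X := X))
    simpa using this
  | succ n ih =>
    intro F _ _ H hH
    let H' : E × P → (E →L[ℝ] F) := fun q =>
      (fderiv ℝ H q).comp (ContinuousLinearMap.inl ℝ E P)
    have hH' : ContDiffOn ℝ ∞ H' U :=
      (hH.fderiv_of_isOpen hU (by simp)).clm_comp contDiffOn_const
    have hd : ∀ x t, HasFDerivAt (fun x => H (x, ι t)) (H' (x, ι t)) x := by
      intro x t
      have h1 : HasFDerivAt H (fderiv ℝ H (x, ι t)) (x, ι t) :=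
        ((hH.contDiffAt (hU.mem_nhds (hιU x t))).differentiableAt (by simp)).hasFDerivAt
      exact h1.comp x (hasFDerivAt_prodMk_left x (ι t))
    have key : ∀ x, HasFDerivAt (fun x => ∫ t, H (x, ι t) ∂μ) (∫ t, H' (x, ι t) ∂μ) x := by
      intro x₀
      have hK : IsCompact (Metric.closedBall x₀ 1 ×ˢ (univ : Set X)) :=
        (isCompact_closedBall x₀ 1).prod isCompact_univ
      obtain ⟨C, hC⟩ := hK.exists_bound_of_continuousOn (hc hH'.continuousOn).continuousOn
      have hm : ∀ {G : Type} [NormedAddCommGroup G] {g : X → G}, Continuous g →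
          Integrable g μ := fun hg =>
        integrableOn_univ.1 (hg.continuousOn.integrableOn_compact isCompact_univ)
      refine hasFDerivAt_integral_of_dominated_of_fderiv_le (bound := fun _ => C)
        (F := fun x t => H (x, ι t)) (F' := fun x t => H' (x, ι t))
        (Metric.ball_mem_nhds x₀ one_pos) ?_ ?_ ?_ ?_ (integrable_const C) ?_
      · exact Filter.Eventually.of_forall fun x =>
          (hm ((hc hH.continuousOn).comp (Continuous.prodMk_right x))).aestronglyMeasurable
      · exact hm ((hc hH.continuousOn).comp (Continuous.prodMk_right x₀))
      · exact (hm ((hc hH'.continuousOn).comp (Continuous.prodMk_right x₀))).aestronglyMeasurable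
      · exact Filter.Eventually.of_forall fun t x hx =>
          hC (x, t) ⟨Metric.ball_subset_closedBall hx, mem_univ _⟩
      · exact Filter.Eventually.of_forall fun t x _ => hd x t
    rw [Nat.cast_succ, contDiff_succ_iff_hasFDerivAt]
    exact ⟨_, ih hH', key⟩

theorem contDiff_backprojFun {d : ℕ} {η : Line d → ℝ} (hη : IsSmoothOnLines η) :
    ContDiff ℝ ∞ (backprojFun η) := by
  classical
  have hn : ∀ p : Space d, p ≠ 0 → ‖p‖⁻¹ • p ∈ Metric.sphere (0 : Space d) 1 := by
    intro p hp
    simp [norm_smul, hp]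
  let U : Set (Space d × Space d) := {q | q.2 ≠ 0}
  have hU : IsOpen U := isOpen_ne_fun continuous_snd continuous_const
  let H : Space d × Space d → ℝ := fun q =>
    if h : q.2 ≠ 0 then η (lineThrough q.1 ⟨_, hn q.2 h⟩) else 0
  let Φ : Space d × Space d → Space d × Space d := fun q =>
    (q.1 - ⟪q.1, ‖q.2‖⁻¹ • q.2⟫_ℝ • (‖q.2‖⁻¹ • q.2), ‖q.2‖⁻¹ • q.2)
  have hΦ : ∀ q ∈ U, ContDiffAt ℝ ∞ Φ q := by
    intro q hq
    have h1 : ContDiffAt ℝ ∞ (fun q : Space d × Space d => ‖q.2‖⁻¹ • q.2) q :=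
      ((contDiffAt_snd.norm ℝ hq).inv (norm_ne_zero_iff.2 hq)).smul contDiffAt_snd
    exact (contDiffAt_fst.sub ((contDiffAt_fst.inner ℝ h1).smul h1)).prodMk h1
  have hH : ContDiffOn ℝ ∞ H U := by
    intro q hq
    refine ContDiffAt.contDiffWithinAt ?_
    obtain ⟨g, hg, hηg⟩ := hη (lineThrough q.1 ⟨_, hn q.2 hq⟩)
    rw [nhds_subtype_eq_comap, Filter.eventually_comap] at hηg
    refine (hg.contDiffAt.comp q (hΦ q hq)).congr_of_eventuallyEq ?_
    filter_upwards [hU.mem_nhds hq, (hΦ q hq).continuousAt.eventually hηg] with q' hq' hW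
    have : H q' = η (lineThrough q'.1 ⟨_, hn q'.2 hq'⟩) := dif_pos hq'
    rw [this]
    exact hW _ rfl
  rw [contDiff_infty]
  intro n
  have key := contDiff_integral_aux (μ := (volume : Measure (Space d)).toSphere)
    (ι := fun θ : Metric.sphere (0 : Space d) 1 => θ.1) continuous_subtype_val hU
    (fun x θ => Metric.ne_of_mem_sphere θ.2 one_ne_zero) n hH
  convert key using 2 with x
  refine integral_congr_ae (Filter.Eventually.of_forall fun θ => ?_)
  have h0 : θ.1 ≠ 0 := Metric.ne_of_mem_sphere θ.2 one_ne_zero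
  have h1 : ‖θ.1‖ = 1 := by simp
  have h2 : H (x, θ.1) = η (lineThrough x ⟨_, hn θ.1 h0⟩) := dif_pos h0
  change η (lineThrough x θ) = H (x, θ.1)
  rw [h2]
  congr 2
  ext1
  simp

theorem integrable_lineThrough {d : ℕ} {η : Line d → ℝ} (hη : IsSmoothOnLines η) (x : Space d) :
    Integrable (fun θ => η (lineThrough x θ)) (volume : Measure (Space d)).toSphere := by
  have hc : Continuous η := by
    rw [continuous_iff_continuousAt]
    intro γ
    obtain ⟨g, hg, h⟩ := hη γ
    exact (hg.continuous.comp continuous_subtype_val).continuousAt.congr_of_eventuallyEq h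
  have hl : Continuous (fun θ : Metric.sphere (0 : Space d) 1 => lineThrough x θ) :=
    Continuous.subtype_mk (by fun_prop) _
  exact integrableOn_univ.1 ((hc.comp hl).continuousOn.integrableOn_compact isCompact_univ)

/-- The formal adjoint `X^*` of the X-ray transform, from smooth functions on `Γ` to smooth
functions on `ℝ^d`. -/
def backproj (d : ℕ) : SmoothLineFun d →ₗ[ℝ] SmoothFun d where
  toFun η := ⟨backprojFun η.1, contDiff_backprojFun η.2⟩
  map_add' a b := by
    ext x
    exact integral_add (integrable_lineThrough a.2 x) (integrable_lineThrough b.2 x)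
  map_smul' c a := by
    ext x
    exact integral_const_mul c _

/-- The X-ray transform `X f` of a compactly supported distribution `f`, defined by duality as a
functional on the smooth functions on `Γ`: `⟨X f, η⟩ = ⟨f, X^* η⟩`. -/
def xray {d : ℕ} (f : Distr d) (hf : IsCompact (dsupport f)) : SmoothLineFun d →ₗ[ℝ] ℂ :=
  pair f hf ∘ₗ backproj d

/-- A functional on the smooth functions on `Γ` vanishes on a set `W` of lines if it is zero on all
test functions whose support is a compact subset of `W`. -/
def VanishesOnLines {d : ℕ} (u : SmoothLineFun d →ₗ[ℝ] ℂ) (W : Set (Line d)) : Prop :=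
  ∀ η : SmoothLineFun d, HasCompactSupport η.1 → tsupport η.1 ⊆ W → u η = 0

end

end XRay

/-!
If `ψ` is a test function supported in `V`, then `X ψ` is a smooth function on `Γ` with compact
support in the set of lines meeting `V`, and polar coordinates give
`X^* X ψ (y) = 2 ∫ ψ(x) |y - x| ^ (1 - d) dx` (`backprojFun_xrayFun`). So the vanishing of `X f` on
the lines through `V`, together with `f|_V = 0`, says that the potential `f * |·| ^ (1 - d)` is zero
on `V` (`pair_translate_kern_eq_zero`); the singularity of the kernel does not matter, because `f` is
supported away from the points considered. The theorem thus becomes a unique continuation statement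
for this potential.

Regularizing by a test function `ρ` with small support replaces `f` by a continuous function `G` with
compact support which vanishes near a point of `V`, say `0`, and whose potential is zero there
(`potentialVanishes_pair_translate`). Differentiating the potential twice and summing gives its
Laplacian, and `Δ |z| ^ (-2a) = 2a (2a + 2 - d) |z| ^ (-2a - 2)`, where for `a = (d - 1) / 2 + k` the
factor `2a (2a + 2 - d)` is never zero (here `d ≥ 2` enters). So the potentials of `G` for all
kernels `|z| ^ (1 - d - 2k)` vanish near `0` (`PotentialVanishes.add_one`), and then first derivatives show
that the same holds for `y_i G` and `k ≥ 1` (`PotentialVanishes.inner_smul`). Iterating, and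
evaluating at the point `0`, one finds that `G` is orthogonal to `|y| ^ (1 - d) p (y / |y| ^ 2)` for
every polynomial `p`. The inversion `y ↦ y / |y| ^ 2` is injective, so by the Stone-Weierstrass
theorem `G = 0` (`integral_smul_eq_zero_of_potentialVanishes`). As `ρ` was arbitrary, `f = 0`.

The passage between `f` and functions rests on one fact, that a distribution commutes with integrals
of smooth families of test functions (`map_integral_slice`). On test functions supported in a fixed
compact set, a distribution is a finite sum of continuous functionals of the derivatives
(`exists_finite_order_representation`, by the Hahn-Banach theorem), and in the Banach spaces of
bounded continuous functions Bochner integrals commute with continuous functionals.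
-/

namespace XRay

open TopologicalSpace (Compacts)
open scoped BoundedContinuousFunction

/-! ### Distributions on test functions with fixed support -/

/-- A continuous functional on a countable product depends on finitely many coordinates only. -/
theorem exists_sum_of_continuous_pi {B : ℕ → Type*} [∀ i, NormedAddCommGroup (B i)]
    [∀ i, NormedSpace ℝ (B i)] (T : (∀ i, B i) →L[ℝ] ℂ) :
    ∃ s : Finset ℕ, ∀ x, T x = ∑ i ∈ s, T (Pi.single i (x i)) := by
  have h0 : ∀ᶠ x in 𝓝 (0 : ∀ i, B i), ‖T x‖ < 1 := by
    have := (T.continuous.norm).tendsto 0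
    simp only [map_zero, norm_zero] at this
    exact this.eventually_lt_const one_pos
  rw [nhds_pi, Filter.eventually_iff, Filter.mem_pi'] at h0
  obtain ⟨s, t, ht, hs⟩ := h0
  -- By homogeneity, `T` vanishes where it is bounded on a line.
  have key : ∀ x : ∀ i, B i, (∀ i ∈ s, x i = 0) → T x = 0 := by
    intro x hx
    by_contra hne
    have hpos : 0 < ‖T x‖ := norm_pos_iff.2 hne
    have : (‖T x‖⁻¹ • x) ∈ {x | ‖T x‖ < 1} := hs fun i hi => by
      rw [Pi.smul_apply, hx i hi, smul_zero]
      exact mem_of_mem_nhds (ht i)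
    simp only [map_smul, norm_smul, mem_ofPred_eq, norm_inv, norm_norm,
      inv_mul_cancel₀ hpos.ne', lt_self_iff_false] at this
  refine ⟨s, fun x => ?_⟩
  rw [← sub_eq_zero, ← map_sum, ← map_sub]
  refine key _ fun i hi => ?_
  simp [Finset.sum_apply, Finset.sum_pi_single, hi]

/-- Hahn-Banach extension of a functional on a space whose topology is induced by a countable family
of maps to normed spaces. -/
theorem exists_sum_of_isEmbedding_pi {E : Type*} [AddCommGroup E] [Module ℝ E]
    [TopologicalSpace E] {B : ℕ → Type*} [∀ i, NormedAddCommGroup (B i)]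
    [∀ i, NormedSpace ℝ (B i)] (J : ∀ i, E →L[ℝ] B i) (hJ : IsEmbedding (fun x i => J i x))
    (f : E →L[ℝ] ℂ) :
    ∃ (s : Finset ℕ) (L : ∀ i, B i →L[ℝ] ℂ), ∀ x, f x = ∑ i ∈ s, L i (J i x) := by
  let J' := ContinuousLinearMap.pi J
  let e := LinearEquiv.ofInjective J'.toLinearMap (show Function.Injective J' from hJ.injective)
  have he : Continuous e.symm := by
    rw [hJ.isInducing.continuous_iff]
    convert continuous_subtype_val using 1
    ext1 x
    exact congrArg Subtype.val (e.apply_symm_apply x)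
  let T₀ : LinearMap.range J'.toLinearMap →L[ℝ] ℂ := f.comp ⟨e.symm.toLinearMap, he⟩
  obtain ⟨T, hT⟩ := T₀.exist_extension_of_finiteDimensional_range
  obtain ⟨s, hs⟩ := exists_sum_of_continuous_pi T
  refine ⟨s, fun i => T.comp (ContinuousLinearMap.single ℝ _ i), fun x => ?_⟩
  have h1 : T₀ (e x) = T (J' x) := by rw [hT]; rfl
  have h2 : T₀ (e x) = f x := congrArg f (e.symm_apply_apply x)
  rw [← h2, h1, hs]
  rfl

/-- On test functions supported in a fixed compact set, a distribution has finite order. -/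
theorem exists_finite_order_representation {d : ℕ} (f : Distr d) (K : Compacts (Space d)) :
    ∃ (s : Finset ℕ) (L : ∀ i : ℕ, (Space d →ᵇ (Space d [×i]→L[ℝ] ℝ)) →L[ℝ] ℂ),
      ∀ φ : 𝓓_{K}(Space d, ℝ), f (TestFunction.ofSupportedIn (subset_univ _) φ) =
        ∑ i ∈ s, L i (ContDiffMapSupportedIn.structureMapCLM ℝ ⊤ i φ) := by
  let f' : 𝓓((⊤ : TopologicalSpace.Opens (Space d)), ℝ) →L[ℝ] ℂ := f
  let J : ∀ i : ℕ, 𝓓_{K}(Space d, ℝ) →L[ℝ] (Space d →ᵇ (Space d [×i]→L[ℝ] ℝ)) :=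
    fun i => ContDiffMapSupportedIn.structureMapCLM ℝ ⊤ i
  have hJ : IsEmbedding (fun x i => J i x) :=
    (ContDiffMapSupportedIn.isUniformEmbedding_pi_structureMapCLM ℝ).isEmbedding
  have key := exists_sum_of_isEmbedding_pi (E := 𝓓_{K}(Space d, ℝ))
    (B := fun i : ℕ => (Space d →ᵇ (Space d [×i]→L[ℝ] ℝ)))
  have key' := key J hJ
  exact key' (f'.comp (TestFunction.ofSupportedInCLM ℝ (subset_univ (K : Set (Space d)))))

/-! ### Integrals of smooth families of test functions -/

/-- A jointly continuous family of functions that vanish off a fixed compact set is continuous for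
the sup norm. -/
theorem continuous_boundedContinuousFunction_of_isCompact {X Y F : Type*} [TopologicalSpace X]
    [TopologicalSpace Y] [NormedAddCommGroup F] {φ : X → (Y →ᵇ F)} {K : Set Y} (hK : IsCompact K)
    (hφ : Continuous fun p : X × Y => φ p.1 p.2) (h0 : ∀ x, ∀ y ∉ K, φ x y = 0) :
    Continuous φ := by
  rw [continuous_iff_continuousAt]
  intro x₀
  rw [ContinuousAt, Metric.tendsto_nhds]
  intro ε hε
  have key : ∀ᶠ x in 𝓝 x₀, ∀ y ∈ K, dist (φ x y) (φ x₀ y) < ε / 2 := by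
    refine hK.eventually_forall_of_forall_eventually fun y _ => ?_
    have hc : Continuous fun p : X × Y => dist (φ p.1 p.2) (φ x₀ p.2) :=
      hφ.dist (hφ.comp (continuous_const.prodMk continuous_snd))
    have := hc.tendsto (x₀, y)
    simp only [dist_self] at this
    exact this.eventually_lt_const (half_pos hε)
  filter_upwards [key] with x hx
  refine lt_of_le_of_lt ((BoundedContinuousFunction.dist_le (half_pos hε).le).2 fun y => ?_)
    (half_lt_self hε)
  by_cases hy : y ∈ K
  · exact (hx y hy).le
  · rw [h0 x y hy, h0 x₀ y hy, dist_self]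
    exact (half_pos hε).le

/-- A functional on bounded continuous functions commutes with integrals that are computed
pointwise. -/
theorem map_boundedContinuousFunction_integral {P Y G : Type*} [TopologicalSpace P]
    [MeasurableSpace P] [OpensMeasurableSpace P] {μ : Measure P} [IsFiniteMeasureOnCompacts μ]
    [TopologicalSpace Y] [NormedAddCommGroup G] [NormedSpace ℝ G] [CompleteSpace G]
    {u : P → ℝ} (hu : Continuous u) (hus : HasCompactSupport u) {φ : P → (Y →ᵇ G)}
    (hφ : Continuous φ) {Ψ : Y →ᵇ G} (hΨ : ∀ y, Ψ y = ∫ x, u x • φ x y ∂μ)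
    (L : (Y →ᵇ G) →L[ℝ] ℂ) :
    Integrable (fun x => u x • L (φ x)) μ ∧ L Ψ = ∫ x, u x • L (φ x) ∂μ := by
  have hi : Integrable (fun x => u x • φ x) μ :=
    (hu.smul hφ).integrable_of_hasCompactSupport hus.smul_right
  have hΨ' : Ψ = ∫ x, u x • φ x ∂μ := by
    ext1 y
    rw [hΨ]
    exact (BoundedContinuousFunction.evalCLM ℝ y).integral_comp_comm hi
  constructor
  · simpa using L.integrable_comp hi
  · rw [hΨ', ← L.integral_comp_comm hi]
    simp

theorem hasFDerivAt_integral_smul {P E G : Type*} [TopologicalSpace P]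
    [MeasurableSpace P] [OpensMeasurableSpace P] {μ : Measure P} [IsFiniteMeasureOnCompacts μ]
    [NormedAddCommGroup E] [NormedSpace ℝ E] [FiniteDimensional ℝ E]
    [NormedAddCommGroup G] [NormedSpace ℝ G]
    {u : P → ℝ} (hu : Continuous u) (hus : HasCompactSupport u) {A : P × E → G}
    {A' : P × E → E →L[ℝ] G} (hA : Continuous A) (hA' : Continuous A')
    (h : ∀ p, HasFDerivAt (fun y => A (p.1, y)) (A' p) p.2) (y : E) :
    HasFDerivAt (fun y => ∫ x, u x • A (x, y) ∂μ) (∫ x, u x • A' (x, y) ∂μ) y := by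
  obtain ⟨b, hb⟩ := (hus.isCompact.prod (isCompact_closedBall y 1)).exists_bound_of_continuousOn
    hA'.continuousOn
  have hi : ∀ y, Integrable (fun x => u x • A (x, y)) μ := fun y =>
    (hu.smul (hA.comp (Continuous.prodMk_left y))).integrable_of_hasCompactSupport hus.smul_right
  refine hasFDerivAt_integral_of_dominated_of_fderiv_le (bound := fun x => ‖u x‖ * b)
    (F' := fun y x => u x • A' (x, y))
    (Metric.ball_mem_nhds y one_pos) (.of_forall fun y => (hi y).aestronglyMeasurable)
    (hi y) ?_ (.of_forall fun x z hz => ?_) ?_ (.of_forall fun x z _ => ?_)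
  · exact ((hu.smul (hA'.comp (Continuous.prodMk_left y))).integrable_of_hasCompactSupport
      hus.smul_right).aestronglyMeasurable
  · rw [norm_smul]
    by_cases hx : x ∈ tsupport u
    · exact mul_le_mul_of_nonneg_left (hb (x, z) ⟨hx, Metric.ball_subset_closedBall hz⟩)
        (norm_nonneg _)
    · simp [image_eq_zero_of_notMem_tsupport hx]
  · exact ((hu.integrable_of_hasCompactSupport hus).norm).mul_const b
  · exact (h (x, z)).const_smul (u x)

section Slice

variable {d : ℕ} {P : Type*} [NormedAddCommGroup P] [NormedSpace ℝ P]
  {K : Compacts (Space d)} {H : P × Space d → ℝ}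

/-- The test function `y ↦ H (x, y)`, for a smooth function `H` that vanishes for `y ∉ K`. -/
def slice (hH : ContDiff ℝ ∞ H) (hK : ∀ x, ∀ y ∉ K, H (x, y) = 0) (x : P) :
    𝓓_{K}(Space d, ℝ) where
  toFun y := H (x, y)
  contDiff' := hH.comp (contDiff_const.prodMk contDiff_id)
  zero_on_compl' y hy := hK x y hy

theorem continuous_iteratedFDeriv_slice (hH : ContDiff ℝ ∞ H) (m : ℕ) :
    Continuous fun p : P × Space d => iteratedFDeriv ℝ m (fun y => H (p.1, y)) p.2 := by
  have h : ∀ p : P × Space d, iteratedFDeriv ℝ m (fun y => H (p.1, y)) p.2 =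
      (iteratedFDeriv ℝ m H p).compContinuousLinearMap
        fun _ => ContinuousLinearMap.inr ℝ P (Space d) := by
    intro p
    have h1 : (fun y => H (p.1, y)) =
        (fun q => H (q + (p.1, 0))) ∘ ContinuousLinearMap.inr ℝ P (Space d) := by
      ext y
      simp
    have h2 : ContDiff ℝ ∞ fun q => H (q + (p.1, 0)) := hH.comp (contDiff_id.add contDiff_const)
    rw [h1, ContinuousLinearMap.iteratedFDeriv_comp_right _ h2 _ (by exact_mod_cast le_top),
      iteratedFDeriv_comp_add_right]
    simp
  simp_rw [h]
  exact (ContinuousMultilinearMap.compContinuousLinearMapL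
    fun _ : Fin m => ContinuousLinearMap.inr ℝ P (Space d)).continuous.comp
    (hH.continuous_iteratedFDeriv (by exact_mod_cast le_top))

theorem continuous_slice (hH : ContDiff ℝ ∞ H) (hK : ∀ x, ∀ y ∉ K, H (x, y) = 0) :
    Continuous (slice hH hK) := by
  rw [ContDiffMapSupportedIn.continuous_iff_comp]
  intro m
  refine continuous_boundedContinuousFunction_of_isCompact K.isCompact ?_ fun x y hy => ?_
  · simp only [Function.comp_apply, ContDiffMapSupportedIn.structureMapCLM_top_apply]
    exact continuous_iteratedFDeriv_slice hH m
  · rw [Function.comp_apply, ContDiffMapSupportedIn.structureMapCLM_top_apply]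
    exact ContDiffMapSupportedIn.iteratedFDeriv_zero_on_compl _ hy

variable [MeasurableSpace P] [BorelSpace P] {μ : Measure P} [IsFiniteMeasureOnCompacts μ]

/-- Differentiation under the integral sign, for derivatives of any order. -/
theorem hasFTaylorSeriesUpTo_integral (hH : ContDiff ℝ ∞ H) {u : P → ℝ} (hu : Continuous u)
    (hus : HasCompactSupport u) :
    HasFTaylorSeriesUpTo ∞ (fun y => ∫ x, u x * H (x, y) ∂μ)
      (fun y m => ∫ x, u x • iteratedFDeriv ℝ m (fun y => H (x, y)) y ∂μ) := by
  have hc : ∀ m y, Continuous fun x => u x • iteratedFDeriv ℝ m (fun y => H (x, y)) y :=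
    fun m y => hu.smul ((continuous_iteratedFDeriv_slice hH m).comp (Continuous.prodMk_left y))
  have hs : ∀ m y, HasCompactSupport fun x => u x • iteratedFDeriv ℝ m (fun y => H (x, y)) y :=
    fun m y => hus.smul_right
  have hi : ∀ m y, Integrable (fun x => u x • iteratedFDeriv ℝ m (fun y => H (x, y)) y) μ :=
    fun m y => (hc m y).integrable_of_hasCompactSupport (hs m y)
  refine (hasFTaylorSeriesUpTo_top_iff' le_rfl).2 ⟨fun y => ?_, fun m y => ?_⟩
  · have := (ContinuousMultilinearMap.apply ℝ (fun _ : Fin 0 => Space d) ℝ 0).integral_comp_comm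
      (hi 0 y)
    simpa [ContinuousMultilinearMap.curry0] using this.symm
  · let C := continuousMultilinearCurryLeftEquiv ℝ (fun _ : Fin (m + 1) => Space d) ℝ
    have hint : (∫ x, u x • iteratedFDeriv ℝ m.succ (fun y => H (x, y)) y ∂μ).curryLeft =
        ∫ x, u x • (iteratedFDeriv ℝ m.succ (fun y => H (x, y)) y).curryLeft ∂μ := by
      have := ContinuousLinearMap.integral_comp_comm (𝕜 := ℝ) (E := Space d [×m + 1]→L[ℝ] ℝ)
        (Fₗ := Space d →L[ℝ] Space d [×m]→L[ℝ] ℝ)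
        C.toContinuousLinearEquiv.toContinuousLinearMap (hi (m + 1) y)
      simp only [map_smul] at this
      exact this.symm
    rw [hint]
    have hcl : Continuous fun p : P × Space d =>
        (iteratedFDeriv ℝ m.succ (fun y => H (p.1, y)) p.2).curryLeft :=
      C.continuous.comp (continuous_iteratedFDeriv_slice hH (m + 1))
    refine hasFDerivAt_integral_smul (G := Space d [×m]→L[ℝ] ℝ) hu hus
      (continuous_iteratedFDeriv_slice hH m) hcl (fun p => ?_) y
    have h1 : ContDiff ℝ ∞ fun y => H (p.1, y) := hH.comp (contDiff_const.prodMk contDiff_id)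
    exact (contDiff_iff_ftaylorSeries.1 h1).fderiv m (by exact_mod_cast WithTop.coe_lt_top m) p.2

/-- A distribution commutes with integrals of smooth families of test functions. -/
theorem map_integral_slice (f : Distr d) (hH : ContDiff ℝ ∞ H)
    (hK : ∀ x, ∀ y ∉ K, H (x, y) = 0) {u : P → ℝ} (hu : Continuous u) (hus : HasCompactSupport u)
    (Φ : 𝓓_{K}(Space d, ℝ)) (hΦ : ∀ y, Φ y = ∫ x, u x * H (x, y) ∂μ) :
    f (TestFunction.ofSupportedIn (subset_univ _) Φ) =
      ∫ x, u x • f (TestFunction.ofSupportedIn (subset_univ _) (slice hH hK x)) ∂μ := by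
  obtain ⟨s, L, hL⟩ := exists_finite_order_representation f K
  simp_rw [hL]
  have key : ∀ m, Integrable (fun x => u x • L m
      (ContDiffMapSupportedIn.structureMapCLM ℝ ⊤ m (slice hH hK x))) μ ∧
      L m (ContDiffMapSupportedIn.structureMapCLM ℝ ⊤ m Φ) = ∫ x, u x • L m
        (ContDiffMapSupportedIn.structureMapCLM ℝ ⊤ m (slice hH hK x)) ∂μ := by
    intro m
    refine map_boundedContinuousFunction_integral hu hus
      ((ContDiffMapSupportedIn.structureMapCLM ℝ ⊤ m).continuous.comp (continuous_slice hH hK))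
      (fun y => ?_) (L m)
    have h2 : (Φ : Space d → ℝ) = fun y => ∫ x, u x * H (x, y) ∂μ := funext hΦ
    rw [ContDiffMapSupportedIn.structureMapCLM_top_apply, h2]
    simp only [ContDiffMapSupportedIn.structureMapCLM_top_apply, Function.comp_apply]
    exact ((hasFTaylorSeriesUpTo_integral hH hu hus).eq_iteratedFDeriv
      (by exact_mod_cast le_top) y).symm
  simp_rw [Finset.smul_sum]
  rw [integral_finsetSum _ fun m _ => (key m).1]
  exact Finset.sum_congr rfl fun m _ => (key m).2

end Slice

/-! ### Compactly supported distributions and convolutions -/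

section Pairing

variable {d : ℕ}

theorem contDiff_smoothFun (k : SmoothFun d) : ContDiff ℝ ∞ k.1 := k.2

/-- The translate `y ↦ k (y - x)` of a smooth function. -/
def translate (k : SmoothFun d) (x : Space d) : SmoothFun d :=
  ⟨fun y => k.1 (y - x), (contDiff_smoothFun k).comp (contDiff_id.sub contDiff_const)⟩

theorem contDiff_sub_comp (k : SmoothFun d) :
    ContDiff ℝ ∞ fun p : Space d × Space d => k.1 (p.2 - p.1) :=
  (contDiff_smoothFun k).comp (contDiff_snd.sub contDiff_fst)

/-- The superposition `y ↦ ∫ u x * k (y - x) dx` of translates of a smooth function, that is, the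
convolution of `u` and `k`. -/
noncomputable def superposition (u : Space d → ℝ) (hu : Continuous u) (hus : HasCompactSupport u)
    (k : SmoothFun d) : SmoothFun d :=
  ⟨fun y => ∫ x, u x * k.1 (y - x),
    (hasFTaylorSeriesUpTo_integral (contDiff_sub_comp k) hu hus).contDiff⟩

variable (f : Distr d) (hf : IsCompact (dsupport f))

/-- The pairing depends only on the values of a function near the support of the distribution. -/
theorem pair_congr {a b : SmoothFun d} (h : ∀ᶠ y in 𝓝ˢ (dsupport f), a.1 y = b.1 y) :
    pair f hf a = pair f hf b := by
  obtain ⟨U, hU, hfU, hab⟩ := eventually_nhdsSet_iff_exists.1 h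
  obtain ⟨χ, hχ, hχU⟩ := exists_isCutoff_subset hf hU hfU
  rw [pair_eq f hf χ hχ, pair_eq f hf χ hχ]
  congr 1
  ext y
  change χ y * a.1 y = χ y * b.1 y
  by_cases hy : y ∈ tsupport χ
  · rw [hab y (hχU hy)]
  · rw [image_eq_zero_of_notMem_tsupport hy, zero_mul, zero_mul]

theorem pair_eq_zero {a : SmoothFun d} (h : ∀ᶠ y in 𝓝ˢ (dsupport f), a.1 y = 0) :
    pair f hf a = 0 := by
  rw [pair_congr f hf (b := 0) h, map_zero]

theorem pair_testFunction (u : Test d) : pair f hf ⟨u, u.contDiff⟩ = f u := by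
  obtain ⟨χ, hχ⟩ := exists_isCutoff (hf.union u.hasCompactSupport.isCompact)
  rw [pair_eq f hf χ (hχ.filter_mono (nhdsSet_mono subset_union_left))]
  congr 1
  ext y
  change χ y * u y = u y
  by_cases hy : y ∈ tsupport u
  · rw [hχ.self_of_nhdsSet y (Or.inr hy), one_mul]
  · rw [image_eq_zero_of_notMem_tsupport hy, mul_zero]

/-- Cut off near the support of the distribution, the translates of a smooth function form a smooth
family of test functions supported in a fixed compact set. -/
theorem exists_pair_translate_eq_slice (k : SmoothFun d) :
    ∃ (χ : Test d) (K : Compacts (Space d))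
      (hK : ∀ x, ∀ y ∉ K, χ y * k.1 (y - x) = 0)
      (hH : ContDiff ℝ ∞ fun p : Space d × Space d => χ p.2 * k.1 (p.2 - p.1)),
      IsCutoff (dsupport f) χ ∧ tsupport χ ⊆ K ∧ ∀ x, pair f hf (translate k x) =
        f (TestFunction.ofSupportedIn (subset_univ _) (slice hH hK x)) := by
  obtain ⟨χ, hχ⟩ := exists_isCutoff hf
  refine ⟨χ, ⟨tsupport χ, χ.hasCompactSupport⟩, fun x y hy => ?_, ?_, hχ, Subset.rfl, fun x => ?_⟩
  · rw [image_eq_zero_of_notMem_tsupport hy, zero_mul]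
  · exact (χ.contDiff.comp contDiff_snd).mul (contDiff_sub_comp k)
  · rw [pair_eq f hf χ hχ]
    rfl

theorem continuous_pair_translate (k : SmoothFun d) :
    Continuous fun x => pair f hf (translate k x) := by
  obtain ⟨χ, K, hK, hH, -, -, h⟩ := exists_pair_translate_eq_slice f hf k
  simp_rw [h]
  exact (map_continuous f).comp
    ((TestFunction.continuous_ofSupportedIn _).comp (continuous_slice hH hK))

/-- Fubini's theorem for a compactly supported distribution and a convolution. -/
theorem pair_superposition {u : Space d → ℝ} (hu : Continuous u) (hus : HasCompactSupport u)
    (k : SmoothFun d) :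
    pair f hf (superposition u hu hus k) = ∫ x, u x • pair f hf (translate k x) := by
  obtain ⟨χ, K, hK, hH, hχ, hχK, h⟩ := exists_pair_translate_eq_slice f hf k
  simp_rw [h]
  let Φ : 𝓓_{K}(Space d, ℝ) :=
    { toFun := mulTest χ (superposition u hu hus k)
      contDiff' := (mulTest χ (superposition u hu hus k)).contDiff
      zero_on_compl' := fun y hy => by
        change χ y * _ = 0
        rw [image_eq_zero_of_notMem_tsupport fun h => hy (hχK h), zero_mul] }
  rw [← map_integral_slice f hH hK hu hus Φ, pair_eq f hf χ hχ]
  · rfl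
  · intro y
    change χ y * ∫ x, u x * k.1 (y - x) = _
    rw [← integral_const_mul]
    exact integral_congr_ae (.of_forall fun x => mul_left_comm _ _ _)

/-- If `k` vanishes off the ball of radius `r`, then `x ↦ ⟨f, k (· - x)⟩` vanishes at distance
greater than `r` from the support of `f`. -/
theorem pair_translate_eq_zero {k : SmoothFun d} {r : ℝ} (hk : ∀ z, r ≤ ‖z‖ → k.1 z = 0)
    {x : Space d} (hx : ∀ y ∈ dsupport f, r < dist y x) : pair f hf (translate k x) = 0 := by
  refine pair_eq_zero f hf (eventually_nhdsSet_iff_forall.2 fun y hy => ?_)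
  have : ContinuousAt (fun y => dist y x) y := by fun_prop
  filter_upwards [this.eventually_const_lt (hx y hy)] with z hz
  exact hk _ (by rw [← dist_eq_norm]; exact hz.le)

end Pairing

/-! ### Potentials with power kernels -/

section RieszKernels

variable {d : ℕ}

/-- The power `|z| ^ (-2a)` of the Euclidean norm, as a power of the smooth function `|z| ^ 2`. -/
noncomputable def kern (a : ℝ) (z : Space d) : ℝ := (‖z‖ ^ 2) ^ (-a)

theorem continuousOn_kern (a : ℝ) : ContinuousOn (kern (d := d) a) {0}ᶜ := fun _ hz =>
  ((continuous_norm.pow 2).continuousAt.rpow_const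
    (Or.inl (pow_ne_zero 2 (norm_ne_zero_iff.2 hz)))).continuousWithinAt

theorem contDiffAt_kern (a : ℝ) {z : Space d} (hz : z ≠ 0) : ContDiffAt ℝ ∞ (kern a) z :=
  (contDiff_norm_sq ℝ).contDiffAt.rpow_const_of_ne (pow_ne_zero 2 (norm_ne_zero_iff.2 hz))

theorem kern_pos (a : ℝ) {z : Space d} (hz : z ≠ 0) : 0 < kern a z :=
  Real.rpow_pos_of_pos (pow_pos (norm_pos_iff.2 hz) 2) _

theorem kern_mul_kern (a b : ℝ) {z : Space d} (hz : z ≠ 0) :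
    kern a z * kern b z = kern (a + b) z := by
  rw [kern, kern, kern, ← Real.rpow_add (pow_pos (norm_pos_iff.2 hz) 2)]
  congr 1
  ring

theorem norm_sq_mul_kern (a : ℝ) {z : Space d} (hz : z ≠ 0) :
    ‖z‖ ^ 2 * kern (a + 1) z = kern a z := by
  have h : 0 < ‖z‖ ^ 2 := pow_pos (norm_pos_iff.2 hz) 2
  rw [kern, kern, mul_comm, ← Real.rpow_add_one h.ne']
  congr 1
  ring

theorem hasDerivAt_kern (a : ℝ) (z v : Space d) (t : ℝ) (hz : z - t • v ≠ 0) :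
    HasDerivAt (fun t : ℝ => kern a (z - t • v))
      (2 * a * ⟪z - t • v, v⟫_ℝ * kern (a + 1) (z - t • v)) t := by
  have h1 : HasDerivAt (fun t : ℝ => z - t • v) (-v) t := by
    simpa using ((hasDerivAt_id t).smul_const v).const_sub z
  have h2 := h1.norm_sq.rpow_const (p := -a) (Or.inl (pow_ne_zero 2 (norm_ne_zero_iff.2 hz)))
  refine h2.congr_deriv ?_
  simp only [kern, inner_neg_right, show -(a + 1) = -a - 1 by ring]
  ring

/-- `G` is a continuous function with compact support outside of the ball of radius `2 ε`. -/
structure SupportedAway (ε : ℝ) (G : Space d → ℂ) : Prop where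
  continuous : Continuous G
  hasCompactSupport : HasCompactSupport G
  eq_zero : ∀ y, ‖y‖ < 2 * ε → G y = 0

/-- The potential of `G` with respect to the kernel `|z| ^ (-2a)` vanishes in the ball of radius
`ε`. -/
def PotentialVanishes (ε a : ℝ) (G : Space d → ℂ) : Prop :=
  ∀ x, ‖x‖ < ε → ∫ y, kern a (y - x) • G y = 0

variable {ε : ℝ} {G : Space d → ℂ}

theorem SupportedAway.smul (hG : SupportedAway ε G) {q : Space d → ℝ} (hq : Continuous q) :
    SupportedAway ε (fun y => q y • G y) where
  continuous := hq.smul hG.continuous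
  hasCompactSupport := hG.hasCompactSupport.mono fun y hy h => hy (by simp only [h, smul_zero])
  eq_zero y hy := by rw [hG.eq_zero y hy, smul_zero]

theorem SupportedAway.le_norm (hG : SupportedAway ε G) {y : Space d} (hy : y ∈ tsupport G) :
    2 * ε ≤ ‖y‖ := by
  have : tsupport G ⊆ {y | 2 * ε ≤ ‖y‖} :=
    closure_minimal (fun y hy => not_lt.1 fun h => hy (hG.eq_zero y h))
      (isClosed_le continuous_const continuous_norm)
  exact this hy

theorem SupportedAway.sub_ne_zero (hG : SupportedAway ε G) (hε : 0 < ε) {x y : Space d}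
    (hx : ‖x‖ ≤ ε) (hy : y ∈ tsupport G) : y - x ≠ 0 := by
  rw [_root_.sub_ne_zero]
  rintro rfl
  linarith [hG.le_norm hy]

/-- The integrand of a potential is continuous, although the kernel is singular. -/
theorem SupportedAway.continuous_kern_smul (hG : SupportedAway ε G) (hε : 0 < ε) (a : ℝ)
    {x : Space d} (hx : ‖x‖ ≤ ε) : Continuous fun y => kern a (y - x) • G y := by
  rw [continuous_iff_continuousAt]
  intro y
  by_cases hy : y ∈ tsupport G
  · have h : ContinuousAt (kern a) (y - x) :=
      (contDiffAt_kern a (hG.sub_ne_zero hε hx hy)).continuousAt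
    exact (ContinuousAt.comp (f := fun y => y - x) h (by fun_prop)).smul hG.continuous.continuousAt
  · have : (fun y => kern a (y - x) • G y) =ᶠ[𝓝 y] fun _ => 0 := by
      filter_upwards [notMem_tsupport_iff_eventuallyEq.1 hy] with z hz
      rw [hz]
      exact smul_zero _
    exact this.continuousAt

theorem SupportedAway.integrable_kern_smul (hG : SupportedAway ε G) (hε : 0 < ε) (a : ℝ)
    {x : Space d} (hx : ‖x‖ ≤ ε) : Integrable fun y => kern a (y - x) • G y :=
  (hG.continuous_kern_smul hε a hx).integrable_of_hasCompactSupport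
    (hG.hasCompactSupport.mono fun y hy h => hy (by simp only [h, smul_zero]))

theorem eventually_norm_add_smul_lt {x : Space d} (hx : ‖x‖ < ε) (v : Space d) :
    ∀ᶠ t : ℝ in 𝓝 0, ‖x + t • v‖ < ε := by
  have : ContinuousAt (fun t : ℝ => ‖x + t • v‖) 0 := by fun_prop
  exact this.eventually_lt_const (by simpa using hx)

/-- Differentiation of a potential under the integral sign. -/
theorem SupportedAway.hasDerivAt_potential (hG : SupportedAway ε G) (hε : 0 < ε) (a : ℝ)
    {x : Space d} (hx : ‖x‖ < ε) (v : Space d) :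
    HasDerivAt (fun t : ℝ => ∫ y, kern a (y - (x + t • v)) • G y)
      (2 * a * ∫ y, kern (a + 1) (y - x) • (⟪y - x, v⟫_ℝ • G y)) 0 := by
  have hev := eventually_norm_add_smul_lt hx v
  obtain ⟨δ, hδ, hball⟩ := Metric.eventually_nhds_iff_ball.1 hev
  have hcb : ∀ t ∈ Metric.closedBall (0 : ℝ) (δ / 2), ‖x + t • v‖ ≤ ε := fun t ht =>
    (hball t (Metric.closedBall_subset_ball (half_lt_self hδ) ht)).le
  have hcont : ContinuousOn (fun p : ℝ × Space d =>
      (2 * a * ⟪p.2 - x - p.1 • v, v⟫_ℝ * kern (a + 1) (p.2 - x - p.1 • v)) • G p.2)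
      (Metric.closedBall (0 : ℝ) (δ / 2) ×ˢ tsupport G) := by
    have h1 : Continuous fun p : ℝ × Space d => 2 * a * ⟪p.2 - x - p.1 • v, v⟫_ℝ := by fun_prop
    refine (h1.continuousOn.mul ?_).smul (hG.continuous.comp continuous_snd).continuousOn
    refine (continuousOn_kern (a + 1)).comp (f := fun p : ℝ × Space d => p.2 - x - p.1 • v)
      (by fun_prop) ?_
    rintro ⟨t, y⟩ ⟨ht, hy⟩
    change y - x - t • v ≠ 0
    rw [sub_sub]
    exact hG.sub_ne_zero hε (hcb t ht) hy
  obtain ⟨b, hb⟩ := ((isCompact_closedBall (0 : ℝ) (δ / 2)).prod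
    hG.hasCompactSupport.isCompact).exists_bound_of_continuousOn hcont
  have key := hasDerivAt_integral_of_dominated_loc_of_deriv_le (μ := (volume : Measure (Space d)))
    (F := fun (t : ℝ) y => kern a (y - (x + t • v)) • G y)
    (F' := fun (t : ℝ) y =>
      (2 * a * ⟪y - x - t • v, v⟫_ℝ * kern (a + 1) (y - x - t • v)) • G y)
    (x₀ := 0) (bound := (tsupport G).indicator fun _ => b)
    (Metric.ball_mem_nhds 0 (half_pos hδ)) ?_ ?_ ?_ (.of_forall fun y t ht => ?_) ?_
    (.of_forall fun y t ht => ?_)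
  · refine key.2.congr_deriv ?_
    rw [← integral_const_mul]
    refine integral_congr_ae (.of_forall fun y => ?_)
    simp only [zero_smul, sub_zero, Complex.real_smul]
    push_cast
    ring
  · filter_upwards [hev] with t ht
    exact (hG.integrable_kern_smul hε a ht.le).aestronglyMeasurable
  · exact hG.integrable_kern_smul hε a (by simpa using hx.le)
  · have h1 := ((hG.smul (q := fun y => 2 * a * ⟪y - x, v⟫_ℝ)
      (by fun_prop)).integrable_kern_smul hε (a + 1) hx.le).aestronglyMeasurable
    refine h1.congr (.of_forall fun y => ?_)
    simp only [zero_smul, sub_zero, smul_smul]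
    congr 1
    ring
  · by_cases hy : y ∈ tsupport G
    · rw [indicator_of_mem hy]
      exact hb (t, y) ⟨Metric.ball_subset_closedBall ht, hy⟩
    · rw [indicator_of_notMem hy, image_eq_zero_of_notMem_tsupport hy, smul_zero, norm_zero]
  · exact (integrable_indicator_iff (isClosed_tsupport G).measurableSet).2
      (integrableOn_const hG.hasCompactSupport.isCompact.measure_lt_top.ne)
  · by_cases hy : y ∈ tsupport G
    · have := hasDerivAt_kern a (y - x) v t (by
        rw [sub_sub]
        exact hG.sub_ne_zero hε (hcb t (Metric.ball_subset_closedBall ht)) hy)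
      simp_rw [← sub_sub]
      exact this.smul_const (G y)
    · simp only [image_eq_zero_of_notMem_tsupport hy, smul_zero]
      exact hasDerivAt_const t 0

/-- The first derivative, in the direction `v`, of a vanishing potential. -/
theorem PotentialVanishes.integral_inner_sub_smul {a : ℝ} (h : PotentialVanishes ε a G)
    (hG : SupportedAway ε G) (hε : 0 < ε) (ha : a ≠ 0) {x : Space d} (hx : ‖x‖ < ε)
    (v : Space d) : ∫ y, kern (a + 1) (y - x) • (⟪y - x, v⟫_ℝ • G y) = 0 := by
  have h1 := hG.hasDerivAt_potential hε a hx v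
  have h2 : HasDerivAt (fun t : ℝ => ∫ y, kern a (y - (x + t • v)) • G y) 0 0 := by
    refine (hasDerivAt_const (0 : ℝ) (0 : ℂ)).congr_of_eventuallyEq ?_
    filter_upwards [eventually_norm_add_smul_lt hx v] with t ht
    exact h _ ht
  refine (mul_eq_zero.1 (h1.unique h2)).resolve_left ?_
  exact mul_ne_zero two_ne_zero (Complex.ofReal_ne_zero.2 ha)

theorem PotentialVanishes.integral_inner_smul {a : ℝ} (h : PotentialVanishes ε a G)
    (hG : SupportedAway ε G) (hε : 0 < ε) (ha : a ≠ 0) {x : Space d} (hx : ‖x‖ < ε)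
    (v : Space d) : ∫ y, kern (a + 1) (y - x) • (⟪y, v⟫_ℝ • G y) =
      ⟪x, v⟫_ℝ • ∫ y, kern (a + 1) (y - x) • G y := by
  have h1 := h.integral_inner_sub_smul hG hε ha hx v
  rw [← integral_smul, ← sub_eq_zero, ← integral_sub, ← h1]
  · refine integral_congr_ae (.of_forall fun y => ?_)
    simp only [inner_sub_left, Complex.real_smul]
    push_cast
    ring
  · exact (hG.smul (q := fun y => ⟪y, v⟫_ℝ) (by fun_prop)).integrable_kern_smul hε _ hx.le
  · exact (hG.integrable_kern_smul hε _ hx.le).smul ⟪x, v⟫_ℝ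

/-- The second derivative, in the direction `v`, of a vanishing potential. -/
theorem PotentialVanishes.integral_inner_sub_sq_smul {a : ℝ} (h : PotentialVanishes ε a G)
    (hG : SupportedAway ε G) (hε : 0 < ε) (ha : a ≠ 0) {x : Space d} (hx : ‖x‖ < ε)
    (v : Space d) : 2 * (a + 1) * ∫ y, kern (a + 2) (y - x) • (⟪y - x, v⟫_ℝ ^ 2 • G y) =
      ‖v‖ ^ 2 * ∫ y, kern (a + 1) (y - x) • G y := by
  have hGv := hG.smul (q := fun y => ⟪y, v⟫_ℝ) (by fun_prop)
  have h1 := hGv.hasDerivAt_potential hε (a + 1) hx v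
  have hlin : HasDerivAt (fun t : ℝ => ⟪x + t • v, v⟫_ℝ) (‖v‖ ^ 2) 0 := by
    simp_rw [inner_add_left, real_inner_smul_left, real_inner_self_eq_norm_sq]
    simpa using ((hasDerivAt_id (0 : ℝ)).mul_const (‖v‖ ^ 2)).const_add ⟪x, v⟫_ℝ
  have h2 := hlin.smul (hG.hasDerivAt_potential hε (a + 1) hx v)
  have h3 := h1.unique (h2.congr_of_eventuallyEq (by
    filter_upwards [eventually_norm_add_smul_lt hx v] with t ht
    exact h.integral_inner_smul hG hε ha ht v))
  have h4 : ∫ y, kern (a + 2) (y - x) • (⟪y - x, v⟫_ℝ ^ 2 • G y) =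
      (∫ y, kern (a + 1 + 1) (y - x) • (⟪y - x, v⟫_ℝ • (⟪y, v⟫_ℝ • G y))) -
        ⟪x, v⟫_ℝ • ∫ y, kern (a + 1 + 1) (y - x) • (⟪y - x, v⟫_ℝ • G y) := by
    rw [← integral_smul, ← integral_sub]
    · refine integral_congr_ae (.of_forall fun y => ?_)
      simp only [inner_sub_left, Complex.real_smul, show a + 2 = a + 1 + 1 by ring]
      push_cast
      ring
    · exact (hGv.smul (q := fun y => ⟪y - x, v⟫_ℝ) (by fun_prop)).integrable_kern_smul hε _ hx.le
    · exact ((hG.smul (q := fun y => ⟪y - x, v⟫_ℝ) (by fun_prop)).integrable_kern_smul hε _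
        hx.le).smul ⟪x, v⟫_ℝ
  simp only [zero_smul, add_zero, Complex.real_smul] at h3 h4 ⊢
  rw [h4]
  push_cast at h3 ⊢
  linear_combination h3

/-- Taking the Laplacian raises the exponent of the kernel: `Δ |z| ^ (-2a)` is
`2a (2a + 2 - d) |z| ^ (-2a - 2)`. -/
theorem PotentialVanishes.add_one {a : ℝ} (h : PotentialVanishes ε a G)
    (hG : SupportedAway ε G) (hε : 0 < ε) (ha : a ≠ 0) (had : 2 * (a + 1) ≠ d) :
    PotentialVanishes ε (a + 1) G := by
  intro x hx
  have hsum : ∑ i : Fin d, ∫ y, kern (a + 2) (y - x) •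
      (⟪y - x, EuclideanSpace.single i (1 : ℝ)⟫_ℝ ^ 2 • G y) =
      ∫ y, kern (a + 1) (y - x) • G y := by
    rw [← integral_finsetSum]
    · refine integral_congr_ae (.of_forall fun y => ?_)
      by_cases hy : y ∈ tsupport G
      · simp only
        rw [← norm_sq_mul_kern (a + 1) (hG.sub_ne_zero hε hx.le hy), EuclideanSpace.real_norm_sq_eq,
          ← Finset.smul_sum, ← Finset.sum_smul, smul_smul, mul_comm]
        simp [EuclideanSpace.inner_single_right, add_assoc, one_add_one_eq_two]
      · simp [image_eq_zero_of_notMem_tsupport hy]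
    · exact fun i _ => (hG.smul (q := fun y => ⟪y - x, EuclideanSpace.single i (1 : ℝ)⟫_ℝ ^ 2)
        (by fun_prop)).integrable_kern_smul hε _ hx.le
  have h2 := Finset.sum_congr rfl fun (i : Fin d) (_ : i ∈ Finset.univ) =>
    h.integral_inner_sub_sq_smul hG hε ha hx (EuclideanSpace.single i (1 : ℝ))
  rw [← Finset.mul_sum, hsum] at h2
  have hn : ∀ i : Fin d, ‖EuclideanSpace.single i (1 : ℝ)‖ = 1 := fun i => by simp
  simp only [hn, Complex.ofReal_one, one_pow, one_mul,
    Finset.sum_const, Finset.card_univ, Fintype.card_fin, nsmul_eq_mul] at h2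
  have h3 : ((2 * (a + 1) - d : ℝ) : ℂ) * ∫ y, kern (a + 1) (y - x) • G y = 0 := by
    push_cast
    linear_combination h2
  exact (mul_eq_zero.1 h3).resolve_left (Complex.ofReal_ne_zero.2 (sub_ne_zero.2 had))

/-- The first derivatives of a vanishing potential, combined with its Laplacian. -/
theorem PotentialVanishes.inner_smul {a : ℝ} (h : PotentialVanishes ε a G)
    (hG : SupportedAway ε G) (hε : 0 < ε) (ha : a ≠ 0) (had : 2 * (a + 1) ≠ d) (v : Space d) :
    PotentialVanishes ε (a + 1) fun y => ⟪y, v⟫_ℝ • G y := by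
  intro x hx
  rw [h.integral_inner_smul hG hε ha hx v, h.add_one hG hε ha had x hx, smul_zero]

theorem SupportedAway.ne_zero (hG : SupportedAway ε G) (hε : 0 < ε) (y : tsupport G) :
    (y : Space d) ≠ 0 := by
  simpa using hG.sub_ne_zero hε (x := 0) (by simpa using hε.le) y.2

/-- The linear functions of the inverted variable `y / |y| ^ 2`, on the support of `G`. -/
noncomputable def invertedCoord (hG : SupportedAway ε G) (hε : 0 < ε) (v : Space d) :
    C(tsupport G, ℝ) where
  toFun y := ⟪y.1, v⟫_ℝ * kern 1 y.1
  continuous_toFun := by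
    refine Continuous.mul (by fun_prop) ?_
    exact (continuousOn_kern 1).comp_continuous continuous_subtype_val (hG.ne_zero hε)

/-- If the potential of `G` for the kernel `|z| ^ (1 - d)` vanishes near `0`, then so do other
potentials, enough of them to show that `G` is orthogonal to the functions
`|y| ^ (1 - d) p (y / |y| ^ 2)` for all monomials `p`. The monomials are handled in the form
`q y * |y| ^ (-2n)` with `q` of degree `n`. -/
theorem exists_potentialVanishes_of_mem_closure (hd : 2 ≤ d) (hG : SupportedAway ε G) (hε : 0 < ε)
    (h : PotentialVanishes ε ((d - 1) / 2) G) {m : C(tsupport G, ℝ)}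
    (hm : m ∈ Submonoid.closure (range (invertedCoord hG hε))) :
    ∃ (n : ℕ) (q : Space d → ℝ), Continuous q ∧ (∀ y : tsupport G, m y = q y * kern n y.1) ∧
      ∀ k : ℕ, n ≤ k → PotentialVanishes ε ((d - 1) / 2 + k) fun y => q y • G y := by
  have hd' : (2 : ℝ) ≤ d := by exact_mod_cast hd
  have ha : ∀ k : ℕ, ((d : ℝ) - 1) / 2 + k ≠ 0 := fun k => by
    have := Nat.cast_nonneg (α := ℝ) k
    intro h
    linarith
  -- The two sides differ by the odd number `1 + 2 * k`.
  have had : ∀ k : ℕ, 2 * (((d : ℝ) - 1) / 2 + k + 1) ≠ d := fun k => by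
    have := Nat.cast_nonneg (α := ℝ) k
    intro h
    linarith
  induction hm using Submonoid.closure_induction_left with
  | one =>
    refine ⟨0, fun _ => 1, continuous_const, fun y => by simp [kern], fun k _ => ?_⟩
    simp only [one_smul]
    clear * - hG hε ha had h
    induction k with
    | zero => simpa using h
    | succ k ih =>
      have := PotentialVanishes.add_one ih hG hε (ha k) (had k)
      rwa [add_assoc, ← Nat.cast_add_one] at this
  | mul_left m' hm' m hm ih =>
    obtain ⟨v, rfl⟩ := hm'
    obtain ⟨n, q, hq, hmq, hv⟩ := ih
    refine ⟨n + 1, fun y => ⟪y, v⟫_ℝ * q y, by fun_prop, fun y => ?_, fun k hk => ?_⟩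
    · have hk := kern_mul_kern n 1 (hG.ne_zero hε y)
      rw [ContinuousMap.mul_apply, hmq, Nat.cast_add_one, ← hk]
      change ⟪y.1, v⟫_ℝ * kern 1 y.1 * _ = _
      ring
    · obtain ⟨k, rfl⟩ : ∃ j, k = j + 1 := ⟨k - 1, by omega⟩
      have := (hv k (by omega)).inner_smul (hG.smul hq) hε (ha k) (had k) v
      simp only [smul_smul] at this
      rwa [add_assoc, ← Nat.cast_add_one] at this

theorem SupportedAway.integrable_smul_kern_smul (hG : SupportedAway ε G) (hε : 0 < ε) (a : ℝ)
    (p : C(tsupport G, ℝ)) : Integrable (fun y : tsupport G => p y • (kern a y.1 • G y.1))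
      (volume.comap Subtype.val) := by
  have : CompactSpace (tsupport G) := isCompact_iff_compactSpace.1 hG.hasCompactSupport
  have : IsFiniteMeasure ((volume : Measure (Space d)).comap ((↑) : tsupport G → Space d)) := by
    constructor
    rw [comap_subtype_coe_apply (isClosed_tsupport G).measurableSet, image_univ, Subtype.range_coe]
    exact hG.hasCompactSupport.isCompact.measure_lt_top
  have hk : Continuous fun y : tsupport G => kern a y.1 :=
    (continuousOn_kern a).comp_continuous continuous_subtype_val (hG.ne_zero hε)
  exact (p.continuous.smul (hk.smul (hG.continuous.comp continuous_subtype_val))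
    ).integrable_of_hasCompactSupport (HasCompactSupport.of_compactSpace _)

/-- `G` is orthogonal to `|y| ^ (1 - d) p (y / |y| ^ 2)` for all polynomials `p`. -/
theorem integral_mul_of_mem_adjoin (hd : 2 ≤ d) (hG : SupportedAway ε G) (hε : 0 < ε)
    (h : PotentialVanishes ε ((d - 1) / 2) G) {p : C(tsupport G, ℝ)}
    (hp : p ∈ Algebra.adjoin ℝ (range (invertedCoord hG hε))) :
    ∫ y : tsupport G, p y • (kern ((d - 1) / 2) y.1 • G y.1) ∂(volume.comap Subtype.val) = 0 := by
  have hi := fun p => hG.integrable_smul_kern_smul hε (((d : ℝ) - 1) / 2) p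
  rw [← Subalgebra.mem_toSubmodule, Algebra.adjoin_eq_span] at hp
  induction hp using Submodule.span_induction with
  | mem m hm =>
    obtain ⟨n, q, -, hmq, hv⟩ := exists_potentialVanishes_of_mem_closure hd hG hε h hm
    -- At the centre, the weight `|y| ^ (-2n)` is that of a monomial of degree `n` in `y / |y| ^ 2`.
    have h0 := hv n le_rfl 0 (by simpa using hε)
    rw [← h0, ← setIntegral_eq_integral_of_forall_compl_eq_zero (s := tsupport G)]
    · rw [← integral_subtype_comap (isClosed_tsupport G).measurableSet]
      refine integral_congr_ae (.of_forall fun y => ?_)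
      simp only [hmq, sub_zero, smul_smul, ← kern_mul_kern _ _ (hG.ne_zero hε y)]
      congr 1
      ring
    · intro y hy
      simp [image_eq_zero_of_notMem_tsupport hy]
  | zero => simp
  | add p q _ _ hp hq =>
    simp only [ContinuousMap.add_apply, add_smul]
    rw [integral_add (hi p) (hi q), hp, hq, add_zero]
  | smul c p _ hp =>
    simp only [ContinuousMap.smul_apply, smul_assoc]
    rw [integral_smul, hp, smul_zero]

/-- The inversion `y ↦ y / |y| ^ 2` is injective. -/
theorem separatesPoints_invertedCoord (hG : SupportedAway ε G) (hε : 0 < ε) :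
    (Algebra.adjoin ℝ (range (invertedCoord hG hε))).SeparatesPoints := by
  intro x y hxy
  by_contra! hall
  have hx := hG.ne_zero hε x
  have hy := hG.ne_zero hε y
  have h1 : ∀ v, ⟪x.1, v⟫_ℝ * kern 1 x.1 = ⟪y.1, v⟫_ℝ * kern 1 y.1 := fun v =>
    hall _ ⟨invertedCoord hG hε v, Algebra.subset_adjoin (mem_range_self v), rfl⟩
  have h2 : kern 1 x.1 • x.1 = kern 1 y.1 • y.1 := by
    refine ext_inner_right ℝ fun v => ?_
    rw [real_inner_smul_left, real_inner_smul_left, mul_comm, h1 v, mul_comm]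
  have hnorm : ∀ z : Space d, z ≠ 0 → kern 1 z = ‖z‖⁻¹ ^ 2 := fun z hz => by
    rw [kern, Real.rpow_neg_one, inv_pow]
  have h3 : ‖x.1‖ = ‖y.1‖ := by
    have h := congrArg norm h2
    rw [norm_smul, norm_smul, hnorm _ hx, hnorm _ hy] at h
    have hx' := norm_ne_zero_iff.2 hx
    have hy' := norm_ne_zero_iff.2 hy
    simp only [norm_pow, norm_inv, norm_norm] at h
    field_simp at h
    exact h.symm
  have h4 : kern 1 x.1 = kern 1 y.1 := by rw [kern, kern, h3]
  rw [h4] at h2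
  exact hxy (Subtype.ext (smul_right_injective _ (kern_pos 1 hy).ne' h2))

/-- A function whose potential for the kernel `|z| ^ (1 - d)` vanishes near a point, together with
the function itself, is zero. -/
theorem integral_smul_eq_zero_of_potentialVanishes (hd : 2 ≤ d) (hG : SupportedAway ε G)
    (hε : 0 < ε) (h : PotentialVanishes ε ((d - 1) / 2) G) {u : Space d → ℝ} (hu : Continuous u) :
    ∫ y, u y • G y = 0 := by
  have : CompactSpace (tsupport G) := isCompact_iff_compactSpace.1 hG.hasCompactSupport
  let a : ℝ := ((d : ℝ) - 1) / 2
  let ν : Measure (tsupport G) := volume.comap Subtype.val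
  have hk : Continuous fun y : tsupport G => kern a y.1 :=
    (continuousOn_kern a).comp_continuous continuous_subtype_val (hG.ne_zero hε)
  have hk0 : ∀ y : tsupport G, kern a y.1 ≠ 0 := fun y => (kern_pos a (hG.ne_zero hε y)).ne'
  let φ : C(tsupport G, ℝ) :=
    ⟨fun y => u y.1 / kern a y.1, (hu.comp continuous_subtype_val).div hk hk0⟩
  have hφ : ∫ y, u y • G y = ∫ y, φ y • (kern a y.1 • G y.1) ∂ν := by
    rw [← setIntegral_eq_integral_of_forall_compl_eq_zero (s := tsupport G),
      ← integral_subtype_comap (isClosed_tsupport G).measurableSet]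
    · refine integral_congr_ae (.of_forall fun y => ?_)
      change _ = (u y.1 / kern a y.1) • (kern a y.1 • G y.1)
      rw [smul_smul, div_mul_cancel₀ _ (hk0 y)]
    · intro y hy
      simp [image_eq_zero_of_notMem_tsupport hy]
  have hint : Integrable (fun y : tsupport G => kern a y.1 • G y.1) ν := by
    simpa using hG.integrable_smul_kern_smul hε a 1
  set C := ∫ y : tsupport G, ‖kern a y.1 • G y.1‖ ∂ν
  have hC : 0 ≤ C := integral_nonneg fun _ => norm_nonneg _
  have hle : ∀ δ : ℝ, 0 < δ → ‖∫ y, u y • G y‖ ≤ δ * C := by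
    intro δ hδ
    obtain ⟨⟨p, hp⟩, hpφ⟩ :=
      ContinuousMap.exists_mem_subalgebra_near_continuousMap_of_separatesPoints _
        (separatesPoints_invertedCoord hG hε) φ δ hδ
    have hp0 := integral_mul_of_mem_adjoin hd hG hε h hp
    rw [hφ, ← norm_neg, ← zero_sub, ← hp0, ← integral_sub (hG.integrable_smul_kern_smul hε a p)
      (hG.integrable_smul_kern_smul hε a φ), ← integral_const_mul]
    refine norm_integral_le_of_norm_le (hint.norm.const_mul δ) (.of_forall fun y => ?_)
    rw [← sub_smul, norm_smul]
    exact mul_le_mul_of_nonneg_right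
      (((p - φ).norm_coe_le_norm y).trans hpφ.le) (norm_nonneg _)
  rw [← norm_le_zero_iff]
  refine le_of_forall_pos_le_add fun η hη => ?_
  refine (hle (η / (C + 1)) (by positivity)).trans ?_
  rw [zero_add, div_mul_eq_mul_div, div_le_iff₀ (by positivity)]
  nlinarith

end RieszKernels

/-! ### The normal operator of the X-ray transform -/

section NormalOperator

variable {d : ℕ}

/-- Integration in polar coordinates. -/
theorem integral_eq_integral_sphere [Nontrivial (Space d)] {h : Space d → ℝ} (hh : Integrable h) :
    Integrable (fun θ : Metric.sphere (0 : Space d) 1 =>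
        ∫ s in Ioi (0 : ℝ), s ^ (d - 1) * h (s • θ.1)) (volume : Measure (Space d)).toSphere ∧
      ∫ θ : Metric.sphere (0 : Space d) 1, (∫ s in Ioi (0 : ℝ), s ^ (d - 1) * h (s • θ.1))
        ∂(volume : Measure (Space d)).toSphere = ∫ x, h x := by
  let μ : Measure (Space d) := volume
  let e := homeomorphUnitSphereProd (Space d)
  have hmp := μ.measurePreserving_homeomorphUnitSphereProd
  let h' : Metric.sphere (0 : Space d) 1 × Ioi (0 : ℝ) → ℝ := fun p => h (p.2.1 • p.1.1)
  have hcomp : h' ∘ e = fun x => h x.1 := by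
    ext x
    simp only [h', e, Function.comp_apply]
    congr 1
    exact congrArg Subtype.val (e.symm_apply_apply x)
  have hint : Integrable h' (μ.toSphere.prod (.volumeIoiPow (Module.finrank ℝ (Space d) - 1))) := by
    rw [← hmp.integrable_comp_emb (Homeomorph.measurableEmbedding _)]
    change Integrable (h' ∘ e) _
    rw [hcomp]
    exact (integrableOn_iff_comap_subtypeVal (measurableSet_singleton _).compl).1 hh.integrableOn
  have hinner : ∀ θ : Metric.sphere (0 : Space d) 1,
      ∫ s, h' (θ, s) ∂(.volumeIoiPow (Module.finrank ℝ (Space d) - 1)) =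
        ∫ s in Ioi (0 : ℝ), s ^ (d - 1) * h (s • θ.1) := by
    intro θ
    simp only [Measure.volumeIoiPow, ENNReal.ofReal]
    rw [integral_withDensity_eq_integral_smul (measurable_subtype_coe.pow_const _).real_toNNReal,
      integral_subtype_comap measurableSet_Ioi fun a => Real.toNNReal
        (a ^ (Module.finrank ℝ (Space d) - 1)) • h (a • θ.1)]
    refine setIntegral_congr_fun measurableSet_Ioi fun s hs => ?_
    simp only [finrank_euclideanSpace, Fintype.card_fin]
    rw [NNReal.smul_def, Real.coe_toNNReal _ (pow_nonneg (le_of_lt hs) _), smul_eq_mul]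
  constructor
  · refine hint.integral_prod_left.congr (.of_forall fun θ => ?_)
    exact hinner θ
  · simp_rw [← hinner]
    rw [← integral_prod _ hint, ← hmp.integral_comp (Homeomorph.measurableEmbedding _)]
    change ∫ x, (h' ∘ e) x ∂_ = _
    rw [hcomp, integral_subtype_comap (measurableSet_singleton _).compl h,
      restrict_compl_singleton]

/-- A smooth function on `ℝ^d` that agrees with the singular kernel `|z| ^ (-2a)` for `|z| ≥ ε`. -/
theorem exists_smoothFun_eq_kern (a : ℝ) {ε : ℝ} (hε : 0 < ε) :
    ∃ k : SmoothFun d, ∀ z, ε ≤ ‖z‖ → k.1 z = kern a z := by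
  let b : ContDiffBump (0 : Space d) := ⟨ε / 2, ε, half_pos hε, half_lt_self hε⟩
  have hb : ContDiff ℝ ∞ b := b.contDiff
  refine ⟨⟨fun z => (1 - b z) * kern a z, ?_⟩, fun z hz => ?_⟩
  · change ContDiff ℝ ∞ fun z => (1 - b z) * kern a z
    refine contDiff_iff_contDiffAt.2 fun z => ?_
    by_cases hz : z = 0
    · refine (contDiffAt_const (c := (0 : ℝ))).congr_of_eventuallyEq ?_
      filter_upwards [Metric.ball_mem_nhds z (half_pos hε)] with w hw
      rw [b.one_of_mem_closedBall (by subst hz; exact (Metric.mem_ball.1 hw).le), sub_self, zero_mul]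
    · exact (contDiffAt_const.sub hb.contDiffAt).mul (contDiffAt_kern a hz)
  · change (1 - b z) * kern a z = _
    rw [b.zero_of_le_dist (by simpa [b] using hz), sub_zero, one_mul]

/-- The X-ray transform of a function: its integrals over lines. -/
noncomputable def xrayFun (ψ : Space d → ℝ) (γ : Line d) : ℝ := ∫ s : ℝ, ψ (γ.1.1 + s • γ.1.2)

/-- The point with parameter `s` on a line is at distance at least `|s|` from the origin. -/
theorem abs_le_norm_add_smul (γ : Line d) (s : ℝ) : |s| ≤ ‖γ.1.1 + s • γ.1.2‖ := by
  obtain ⟨h1, h2⟩ := γ.2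
  have h : ‖γ.1.1 + s • γ.1.2‖ ^ 2 = ‖γ.1.1‖ ^ 2 + s ^ 2 := by
    rw [norm_add_sq_real, real_inner_smul_right, h2, norm_smul, h1, Real.norm_eq_abs, mul_one,
      sq_abs]
    ring
  have h' : s ^ 2 ≤ ‖γ.1.1 + s • γ.1.2‖ ^ 2 := by nlinarith [sq_nonneg ‖γ.1.1‖]
  simpa using sq_le_sq.1 h'

/-- On `Γ`, the integration may be restricted to a fixed compact interval, and then the formula
defines a smooth function on the ambient space. -/
theorem isSmoothOnLines_xrayFun (ψ : Test d) : IsSmoothOnLines (xrayFun ψ) := by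
  obtain ⟨R, hR⟩ := ψ.hasCompactSupport.isCompact.isBounded.subset_closedBall (0 : Space d)
  let H : (Space d × Space d) × ℝ → ℝ := fun q => ψ (q.1.1 + q.2 • q.1.2)
  have hH : ContDiff ℝ ∞ H := by
    refine ψ.contDiff.comp ?_
    fun_prop
  have hfin : IsFiniteMeasure ((volume : Measure ℝ).comap ((↑) : Icc (-R) R → ℝ)) := by
    constructor
    rw [comap_subtype_coe_apply measurableSet_Icc, image_univ, Subtype.range_coe]
    exact isCompact_Icc.measure_lt_top
  refine fun γ => ⟨fun p => ∫ s : Icc (-R) R, H (p, s.1) ∂(volume.comap Subtype.val), ?_, ?_⟩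
  · rw [contDiff_infty]
    intro n
    exact contDiff_integral_aux continuous_subtype_val isOpen_univ (fun _ _ => mem_univ _) n
      hH.contDiffOn
  · refine .of_forall fun γ' => ?_
    change _ = ∫ s : Icc (-R) R, (fun s => H (γ'.1, s)) s.1 ∂(volume.comap Subtype.val)
    rw [integral_subtype_comap measurableSet_Icc fun s => H (γ'.1, s),
      setIntegral_eq_integral_of_forall_compl_eq_zero]
    · rfl
    · intro s hs
      change ψ (γ'.1.1 + s • γ'.1.2) = 0
      refine image_eq_zero_of_notMem_tsupport fun h => hs ?_
      have h1 := hR h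
      rw [mem_closedBall_zero_iff] at h1
      exact abs_le.1 ((abs_le_norm_add_smul γ' s).trans h1)

theorem continuous_lineThrough :
    Continuous fun p : Space d × Metric.sphere (0 : Space d) 1 => lineThrough p.1 p.2 :=
  Continuous.subtype_mk (by fun_prop) _

theorem lineThrough_add_smul (γ : Line d) (s : ℝ) :
    lineThrough (γ.1.1 + s • γ.1.2) ⟨γ.1.2, by simpa using γ.2.1⟩ = γ := by
  obtain ⟨⟨z, θ⟩, h1, h2⟩ := γ
  simp only at h1 h2
  refine Subtype.ext (Prod.ext ?_ rfl)
  change z + s • θ - ⟪z + s • θ, θ⟫_ℝ • θ = z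
  rw [inner_add_left, real_inner_smul_left, real_inner_self_eq_norm_sq, h1, h2]
  simp

/-- The lines that meet the support of `ψ` form a compact set, being the image of
`tsupport ψ × S^{d-1}` under `lineThrough`. -/
theorem exists_isCompact_support_xrayFun (ψ : Test d) :
    ∃ C : Set (Line d), IsCompact C ∧ Function.support (xrayFun ψ) ⊆ C ∧
      C ⊆ linesMeeting (tsupport ψ) := by
  refine ⟨(fun p : Space d × Metric.sphere (0 : Space d) 1 => lineThrough p.1 p.2) ''
    (tsupport ψ ×ˢ univ), (ψ.hasCompactSupport.isCompact.prod isCompact_univ).image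
      continuous_lineThrough, fun γ hγ => ?_, ?_⟩
  · obtain ⟨s, hs⟩ : ∃ s : ℝ, ψ (γ.1.1 + s • γ.1.2) ≠ 0 := by
      by_contra! h
      exact hγ (by simp [xrayFun, h])
    exact ⟨(_, _), ⟨subset_tsupport _ hs, mem_univ _⟩, lineThrough_add_smul γ s⟩
  · rintro _ ⟨⟨x, θ⟩, ⟨hx, -⟩, rfl⟩
    refine ⟨⟪x, θ.1⟫_ℝ, ?_⟩
    simpa [lineThrough] using hx

theorem hasCompactSupport_xrayFun (ψ : Test d) : HasCompactSupport (xrayFun ψ) := by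
  obtain ⟨C, hC, h, -⟩ := exists_isCompact_support_xrayFun ψ
  exact HasCompactSupport.of_support_subset_isCompact hC h

theorem tsupport_xrayFun_subset (ψ : Test d) :
    tsupport (xrayFun ψ) ⊆ linesMeeting (tsupport ψ) := by
  obtain ⟨C, hC, h, h'⟩ := exists_isCompact_support_xrayFun ψ
  exact (closure_minimal h hC.isClosed).trans h'

/-- The integral over a line through `y`, as the sum of the integrals over two half-lines. -/
theorem xrayFun_lineThrough (ψ : Test d) (y : Space d) (θ : Metric.sphere (0 : Space d) 1) :
    xrayFun ψ (lineThrough y θ) =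
      (∫ s in Ioi (0 : ℝ), ψ (y + s • θ.1)) + ∫ s in Ioi (0 : ℝ), ψ (y - s • θ.1) := by
  have h1 : xrayFun ψ (lineThrough y θ) = ∫ s : ℝ, ψ (y + s • θ.1) := by
    rw [← integral_sub_right_eq_self _ ⟪y, θ.1⟫_ℝ]
    refine integral_congr_ae (.of_forall fun s => ?_)
    simp only [lineThrough]
    congr 1
    module
  have hi : Integrable fun s : ℝ => ψ (y + s • θ.1) := by
    have hθ : θ.1 ≠ 0 := Metric.ne_of_mem_sphere θ.2 one_ne_zero
    refine Continuous.integrable_of_hasCompactSupport (by fun_prop) ?_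
    exact ψ.hasCompactSupport.comp_isClosedEmbedding
      ((Homeomorph.addLeft y).isClosedEmbedding.comp (isClosedEmbedding_smul_left hθ))
  rw [h1, ← intervalIntegral.integral_Iic_add_Ioi hi.integrableOn hi.integrableOn, add_comm]
  congr 1
  have := integral_comp_neg_Ioi (0 : ℝ) fun s => ψ (y + s • θ.1)
  rw [neg_zero] at this
  simpa [sub_eq_add_neg] using this.symm

/-- The normal operator `X^* X` is, up to the factor `2`, the convolution with `|z| ^ (1 - d)`. Away
from the support of `ψ` the kernel may be replaced by a smooth function `k`. -/
theorem backprojFun_xrayFun (hd : 2 ≤ d) (ψ : Test d) {k : SmoothFun d} {ε : ℝ}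
    (hk : ∀ z, ε ≤ ‖z‖ → k.1 z = kern ((d - 1) / 2) z) {y : Space d}
    (hy : ∀ x, ψ x ≠ 0 → ε ≤ ‖y - x‖) :
    backprojFun (xrayFun ψ) y = 2 * ∫ x, ψ x * k.1 (y - x) := by
  have : Nontrivial (Fin d) := Fin.nontrivial_iff_two_le.2 hd
  -- The density of the polar coordinates cancels the kernel.
  have hpow : ∀ {s : ℝ}, 0 < s → ∀ θ : Metric.sphere (0 : Space d) 1, ∀ v,
      (v = s • θ.1 ∨ v = -(s • θ.1)) → s ^ (d - 1) * kern (((d : ℝ) - 1) / 2) v = 1 := by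
    intro s hs θ v hv
    have hn : ‖v‖ = s := by
      rcases hv with rfl | rfl <;> simp [norm_smul, abs_of_pos hs]
    rw [kern, hn, ← Real.rpow_natCast, ← Real.rpow_natCast, ← Real.rpow_mul hs.le,
      ← Real.rpow_add hs, Nat.cast_sub (by omega)]
    convert Real.rpow_zero s using 2
    push_cast
    ring
  have hkc : Continuous k.1 := (contDiff_smoothFun k).continuous
  have hψc : Continuous ψ := ψ.contDiff.continuous
  have hint : ∀ L : Space d ≃ₜ Space d, ∀ g : Space d → ℝ, Continuous g →
      Integrable fun v => ψ (L v) * g v := fun L g hg =>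
    ((hψc.comp L.continuous).mul hg).integrable_of_hasCompactSupport
      (ψ.hasCompactSupport.comp_homeomorph L).mul_right
  -- Each of the two half-lines contributes one copy of the convolution.
  have hplus := integral_eq_integral_sphere (hint (Homeomorph.addLeft y) (fun v => k.1 (-v))
    (hkc.comp continuous_neg))
  have hminus := integral_eq_integral_sphere (hint (Homeomorph.subLeft y) k.1 hkc)
  have eplus : ∀ θ : Metric.sphere (0 : Space d) 1, ∫ s in Ioi (0 : ℝ), ψ (y + s • θ.1) =
      ∫ s in Ioi (0 : ℝ), s ^ (d - 1) *
        (ψ (Homeomorph.addLeft y (s • θ.1)) * k.1 (-(s • θ.1))) := by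
    intro θ
    refine setIntegral_congr_fun measurableSet_Ioi fun s hs => ?_
    simp only [Homeomorph.coe_addLeft]
    by_cases h0 : ψ (y + s • θ.1) = 0
    · simp [h0]
    · rw [hk _ (by simpa using hy _ h0), mul_left_comm, hpow hs θ _ (Or.inr rfl), mul_one]
  have eminus : ∀ θ : Metric.sphere (0 : Space d) 1, ∫ s in Ioi (0 : ℝ), ψ (y - s • θ.1) =
      ∫ s in Ioi (0 : ℝ), s ^ (d - 1) *
        (ψ (Homeomorph.subLeft y (s • θ.1)) * k.1 (s • θ.1)) := by
    intro θ
    refine setIntegral_congr_fun measurableSet_Ioi fun s hs => ?_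
    simp only [Homeomorph.subLeft_apply]
    by_cases h0 : ψ (y - s • θ.1) = 0
    · simp [h0]
    · rw [hk _ (by simpa using hy _ h0), mul_left_comm, hpow hs θ _ (Or.inl rfl), mul_one]
  rw [backprojFun]
  simp_rw [xrayFun_lineThrough, eplus, eminus]
  rw [integral_add hplus.1 hminus.1, hplus.2, hminus.2, two_mul]
  congr 1
  · rw [← integral_add_left_eq_self (fun x => ψ x * k.1 (y - x)) y]
    simp
  · rw [← integral_sub_left_eq_self (fun x => ψ x * k.1 (y - x)) volume y]
    simp

end NormalOperator

/-! ### Unique continuation -/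

section UniqueContinuation

variable {d : ℕ}

theorem eqOn_zero_of_integral_smul_eq_zero {F : Space d → ℂ} (hF : Continuous F)
    {U : Set (Space d)} (hU : IsOpen U)
    (h : ∀ ψ : Test d, tsupport ψ ⊆ U → ∫ x, ψ x • F x = 0) : EqOn F 0 U := by
  have hae := hU.ae_eq_zero_of_integral_contDiff_smul_eq_zero (μ := volume)
    (hF.locallyIntegrable.locallyIntegrableOn U)
    fun g hg hgs hgU => h ⟨g, hg, hgs, subset_univ _⟩ hgU
  exact Measure.eqOn_open_of_ae_eq ((ae_restrict_iff' hU.measurableSet).2 hae) hU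
    hF.continuousOn continuousOn_const

theorem le_dist_of_mem_dsupport {f : Distr d} {V : Set (Space d)} (hfV : IsVanishingOn f V)
    {x₀ : Space d} {r : ℝ} (hr : Metric.ball x₀ r ⊆ V) {y : Space d} (hy : y ∈ dsupport f) :
    r ≤ dist y x₀ := by
  by_contra! h
  exact (notMem_dsupport_iff y).2
    ⟨_, hfV.mono hr, Metric.isOpen_ball, h⟩ hy

/-- The normal operator applied to `f`, that is, the potential of `f`, vanishes near a point
of `V`. -/
theorem pair_translate_kern_eq_zero (hd : 2 ≤ d) {V : Set (Space d)} {f : Distr d}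
    (hf : IsCompact (dsupport f)) (hfV : IsVanishingOn f V)
    (hX : VanishesOnLines (xray f hf) (linesMeeting V)) {x₀ : Space d} {ε : ℝ} (hε : 0 < ε)
    (hV : Metric.ball x₀ (4 * ε) ⊆ V) {k : SmoothFun d}
    (hk : ∀ z, ε ≤ ‖z‖ → k.1 z = kern ((d - 1) / 2) z) {x : Space d} (hx : dist x x₀ < 2 * ε) :
    pair f hf (translate k x) = 0 := by
  refine eqOn_zero_of_integral_smul_eq_zero (continuous_pair_translate f hf k)
    (Metric.isOpen_ball (x := x₀) (ε := 2 * ε)) (fun ψ hψ => ?_) hx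
  have hψV : tsupport ψ ⊆ V := hψ.trans ((Metric.ball_subset_ball (by linarith)).trans hV)
  have h1 : xray f hf ⟨xrayFun ψ, isSmoothOnLines_xrayFun ψ⟩ = 0 :=
    hX _ (hasCompactSupport_xrayFun ψ) fun γ hγ => by
      obtain ⟨s, hs⟩ := tsupport_xrayFun_subset ψ hγ
      exact ⟨s, hψV hs⟩
  have hψc : Continuous ψ := ψ.contDiff.continuous
  have h2 : pair f hf (backproj d ⟨xrayFun ψ, isSmoothOnLines_xrayFun ψ⟩) =
      pair f hf ((2 : ℝ) • superposition ψ hψc ψ.hasCompactSupport k) := by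
    refine pair_congr f hf (eventually_nhdsSet_iff_forall.2 fun y hy => ?_)
    have hy' := le_dist_of_mem_dsupport hfV hV hy
    have hc : ContinuousAt (fun y => dist y x₀) y := by fun_prop
    filter_upwards [hc.eventually_const_lt (show 3 * ε < dist y x₀ by linarith)] with z hz
    refine backprojFun_xrayFun hd ψ hk fun x hx => ?_
    have hx' : dist x x₀ < 2 * ε := hψ (subset_tsupport _ hx)
    rw [← dist_eq_norm]
    linarith [dist_triangle z x x₀]
  rw [← pair_superposition f hf hψc ψ.hasCompactSupport k]
  have h3 : pair f hf ((2 : ℝ) • superposition ψ hψc ψ.hasCompactSupport k) = 0 := h2.symm.trans h1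
  rw [map_smul] at h3
  exact (smul_eq_zero.1 h3).resolve_left two_ne_zero

variable {f : Distr d} {hf : IsCompact (dsupport f)} {x₀ : Space d} {ε : ℝ}

/-- The regularization of `f` by a smooth function `ρ` supported in a small ball, recentred at `x₀`,
is a continuous function with compact support that vanishes near `0`. -/
theorem supportedAway_pair_translate (hε : 0 < ε) (hfx : ∀ y ∈ dsupport f, 4 * ε ≤ dist y x₀)
    {ρ : SmoothFun d} (hρ : ∀ z, ε ≤ ‖z‖ → ρ.1 z = 0) :
    SupportedAway ε fun y => pair f hf (translate ρ (y + x₀)) where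
  continuous := (continuous_pair_translate f hf ρ).comp (by fun_prop)
  hasCompactSupport := by
    have h : HasCompactSupport fun x => pair f hf (translate ρ x) := by
      refine HasCompactSupport.intro (hf.cthickening (r := ε)) fun x hx => ?_
      refine pair_translate_eq_zero f hf hρ fun y hy => ?_
      rw [dist_comm]
      by_contra! h
      exact hx (Metric.mem_cthickening_of_dist_le x y ε _ hy h)
    exact h.comp_homeomorph (Homeomorph.addRight x₀)
  eq_zero y hy := by
    refine pair_translate_eq_zero f hf hρ fun y' hy' => ?_
    have h1 := hfx y' hy'
    have h2 := dist_triangle y' (y + x₀) x₀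
    rw [dist_eq_norm (y + x₀), add_sub_cancel_right] at h2
    linarith

/-- The potential of the regularization of `f` is the regularization of the potential of `f`, and so
it vanishes near the centre if the potential of `f` does. -/
theorem potentialVanishes_pair_translate (hε : 0 < ε)
    (hfx : ∀ y ∈ dsupport f, 4 * ε ≤ dist y x₀) {ρ : Test d} (hρ : tsupport ρ ⊆ Metric.ball 0 ε)
    {a : ℝ} {k : SmoothFun d} (hk : ∀ z, ε ≤ ‖z‖ → k.1 z = kern a z)
    (hkf : ∀ x, dist x x₀ < 2 * ε → pair f hf (translate k x) = 0) :
    PotentialVanishes ε a fun y => pair f hf (translate ⟨ρ, ρ.contDiff⟩ (y + x₀)) := by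
  intro x hx
  have hρ0 : ∀ z, ε ≤ ‖z‖ → ρ z = 0 := fun z hz =>
    image_eq_zero_of_notMem_tsupport fun h => by
      have := mem_ball_zero_iff.1 (hρ h)
      linarith
  have hG := supportedAway_pair_translate (hf := hf) hε hfx (ρ := ⟨ρ, ρ.contDiff⟩) hρ0
  have hρc : Continuous ρ := ρ.contDiff.continuous
  -- Only a neighbourhood of the support of `f` matters, so the kernel may be cut off outside of it.
  obtain ⟨χ, hχ⟩ := exists_isCutoff (hf.cthickening (r := 2 * ε))
  have hχ1 : ∀ y ∈ dsupport f, ∀ z, dist z y ≤ 2 * ε → χ z = 1 := fun y hy z hz =>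
    hχ.self_of_nhdsSet z (Metric.mem_cthickening_of_dist_le z y _ _ hy hz)
  have hkc : Continuous fun y => k.1 (y - (x + x₀)) :=
    (contDiff_smoothFun k).continuous.comp (by fun_prop)
  have hχc : Continuous χ := χ.contDiff.continuous
  let u : Space d → ℝ := fun y => χ y * k.1 (y - (x + x₀))
  have hu : Continuous u := hχc.mul hkc
  have hus : HasCompactSupport u := χ.hasCompactSupport.mul_right
  have h1 : ∫ y, kern a (y - x) • pair f hf (translate ⟨ρ, ρ.contDiff⟩ (y + x₀)) =
      ∫ y, u y • pair f hf (translate ⟨ρ, ρ.contDiff⟩ y) := by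
    rw [← integral_add_right_eq_self (fun y => u y • pair f hf (translate _ y)) x₀]
    refine integral_congr_ae (.of_forall fun y => ?_)
    by_cases h0 : pair f hf (translate ⟨ρ, ρ.contDiff⟩ (y + x₀)) = 0
    · simp only [h0, smul_zero]
    · have hy : 2 * ε ≤ ‖y‖ := not_lt.1 fun h => h0 (hG.eq_zero y h)
      have hχy : χ (y + x₀) = 1 := by
        by_contra hne
        refine h0 (pair_translate_eq_zero f hf hρ0 fun y' hy' => ?_)
        by_contra! h
        exact hne (hχ1 y' hy' _ (by rw [dist_comm]; linarith))
      have hyx : ε ≤ ‖y - x‖ := by linarith [norm_sub_norm_le y x]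
      simp only [u, hχy, one_mul, add_sub_add_right_eq_sub, hk _ hyx]
  rw [h1, ← pair_superposition f hf hu hus ⟨ρ, ρ.contDiff⟩]
  -- Commutativity of the convolution of `ρ` and the kernel.
  have h2 : pair f hf (superposition u hu hus ⟨ρ, ρ.contDiff⟩) =
      pair f hf (superposition ρ hρc ρ.hasCompactSupport (translate k (x + x₀))) := by
    refine pair_congr f hf (eventually_nhdsSet_iff_forall.2 fun y hy => ?_)
    filter_upwards [Metric.ball_mem_nhds y hε] with z hz
    change ∫ w, χ w * k.1 (w - (x + x₀)) * ρ (z - w) = ∫ w, ρ w * k.1 (z - w - (x + x₀))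
    rw [← integral_sub_left_eq_self (fun w => ρ w * k.1 (z - w - (x + x₀))) volume z]
    refine integral_congr_ae (.of_forall fun w => ?_)
    simp only [sub_sub_cancel]
    by_cases h0 : ρ (z - w) = 0
    · simp [h0]
    · have hzw : ‖z - w‖ < ε := not_le.1 fun h => h0 (hρ0 _ h)
      have : dist w y ≤ 2 * ε := by
        rw [← dist_eq_norm] at hzw
        have := dist_triangle_left w y z
        linarith [Metric.mem_ball.1 hz]
      rw [hχ1 y hy w this, one_mul, mul_comm]
  rw [h2, pair_superposition f hf hρc ρ.hasCompactSupport]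
  refine integral_eq_zero_of_ae (.of_forall fun v => ?_)
  by_cases h0 : ρ v = 0
  · simp [h0]
  · have hv : ‖v‖ < ε := not_le.1 fun h => h0 (hρ0 _ h)
    have h3 : translate (translate k (x + x₀)) v = translate k (x + v + x₀) := by
      ext y
      change k.1 (y - v - (x + x₀)) = k.1 (y - (x + v + x₀))
      exact congrArg k.1 (by abel)
    have h4 : dist (x + v + x₀) x₀ < 2 * ε := by
      rw [dist_eq_norm, add_sub_cancel_right]
      linarith [norm_add_le x v]
    simp only [h3, hkf _ h4, smul_zero, Pi.zero_apply]

/-- A compactly supported distribution that vanishes on a nonempty open set `V`, and whose X-ray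
transform vanishes on the lines through `V`, is zero. -/
theorem eq_zero_of_vanishesOnLines (hd : 2 ≤ d) {V : Set (Space d)} (hV : IsOpen V)
    (hVne : V.Nonempty) (f : Distr d) (hf : IsCompact (dsupport f)) (hfV : IsVanishingOn f V)
    (hX : VanishesOnLines (xray f hf) (linesMeeting V)) : f = 0 := by
  obtain ⟨x₀, hx₀⟩ := hVne
  obtain ⟨r, hr, hrV⟩ := Metric.isOpen_iff.1 hV x₀ hx₀
  obtain ⟨ε, hε, hεr⟩ : ∃ ε : ℝ, 0 < ε ∧ 4 * ε ≤ r := ⟨r / 4, by linarith, by linarith⟩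
  have hεV : Metric.ball x₀ (4 * ε) ⊆ V := (Metric.ball_subset_ball hεr).trans hrV
  have hfx : ∀ y ∈ dsupport f, 4 * ε ≤ dist y x₀ := fun y hy => le_dist_of_mem_dsupport hfV hεV hy
  obtain ⟨k, hk⟩ := exists_smoothFun_eq_kern (d := d) (((d : ℝ) - 1) / 2) hε
  have hkf := fun x => pair_translate_kern_eq_zero hd hf hfV hX hε hεV hk (x := x)
  ext u
  have huc : Continuous u := u.contDiff.continuous
  -- It suffices that `F x = ⟨f, u (· - x)⟩` vanishes near `x = 0`.
  have key : EqOn (fun x => pair f hf (translate ⟨u, u.contDiff⟩ x)) 0 (Metric.ball 0 ε) := by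
    refine eqOn_zero_of_integral_smul_eq_zero (continuous_pair_translate f hf _)
      Metric.isOpen_ball fun ρ hρ => ?_
    have hρc : Continuous ρ := ρ.contDiff.continuous
    have hG := supportedAway_pair_translate (hf := hf) hε hfx (ρ := ⟨ρ, ρ.contDiff⟩) fun z hz =>
      image_eq_zero_of_notMem_tsupport fun h => by
        have := mem_ball_zero_iff.1 (hρ h)
        linarith
    have hP := potentialVanishes_pair_translate (hf := hf) hε hfx hρ hk hkf
    have h0 := integral_smul_eq_zero_of_potentialVanishes hd hG hε hP
      (u := fun y => u (y + x₀)) (by fun_prop)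
    rw [integral_add_right_eq_self (fun y => u y • pair f hf (translate ⟨ρ, ρ.contDiff⟩ y)) x₀,
      ← pair_superposition f hf huc u.hasCompactSupport] at h0
    -- `∫ ρ F` is the pairing of `u` with the regularization of `f` by `ρ`.
    rw [← pair_superposition f hf hρc ρ.hasCompactSupport, ← h0]
    congr 1
    ext y
    change ∫ x, ρ x * u (y - x) = ∫ x, u x * ρ (y - x)
    rw [← integral_sub_left_eq_self (fun x => u x * ρ (y - x)) volume y]
    simp only [sub_sub_cancel, mul_comm]
  have h := key (Metric.mem_ball_self hε)
  have ht : translate ⟨u, u.contDiff⟩ 0 = ⟨u, u.contDiff⟩ := by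
    ext y
    change u (y - 0) = u y
    rw [sub_zero]
  simp only [ht, pair_testFunction] at h
  exact h

end UniqueContinuation

end XRay

theorem theorem2 {d : ℕ} (hd : 2 ≤ d) (V : Set (XRay.Space d)) (hV : IsOpen V)
    (hVne : V.Nonempty) (f : XRay.Distr d) (hf : IsCompact (Distribution.dsupport f))
    (hfV : Distribution.IsVanishingOn f V)
    (hX : XRay.VanishesOnLines (XRay.xray f hf) (XRay.linesMeeting V)) :
    f = 0 := by
  exact XRay.eq_zero_of_vanishesOnLines hd hV hVne f hf hfV hX
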